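/- **Conventions.** Let $K$ be a field with $\operatorname{char}K\neq 2$ and $V=\bigoplus_{k\in\mathbb Z}V^k$ a $\mathbb Z$-graded $K$-vector space. Degrees of homogeneous elements are written as the elements themselves in exponents of $-1$. Let $V\otimes V$ carry the total grading, and let $s$ be the suspension, $|sX|=|X|+1$. *Graded Balavoine algebra.* For a graded vector space $A$ let $\mathrm{CL}^n(A)$ be the space of degree $n$ linear maps $f=\sum_{i\ge1}f_i:\bigoplus_{i\ge 1}A^{\otimes i}\to A$. For $f\in \mathrm{CL}^m(A)$, $g\in\mathrm{CL}^n(A)$ put $[f,g]_B=f\,\bar\circ\, g-(-1)^{mn}g\,\bar\circ\, f$, where the component of $f\,\bar\circ\, g$ on $A^{\otimes r}$ is $\sum_{i+j=r+1}\sum_{k=1}^{i}f_i\,\bar\circ_k\, g_j$ and, on homogeneous elements, $$(f_i\bar\circ_k g_j)(v_1,\dots,v_r)=\sum_{\sigma\in \mathbb S_{(k-1,j-1)}}(-1)^{n(v_{\sigma(1)}+\cdots+v_{\sigma(k-1)})}\varepsilon(\sigma)\,f_i\big(v_{\sigma(1)},\dots,v_{\sigma(k-1)},g_j(v_{\sigma(k)},\dots,v_{\sigma(k+j-2)},v_{k+j-1}),v_{k+j},\dots,v_r\big);$$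 here $\sigma$ runs over the $(k-1,j-1)$-shuffles and $\varepsilon(\sigma)$ is the Koszul sign of the permutation of the $v$'s. A Leibniz$_\infty$-algebra structure on $A$ is an element $\ell=\sum_{i\ge1}\ell_i\in\mathrm{CL}^1(A)$ with $[\ell,\ell]_B=0$. *Nambu side.* Let $\mathrm{CV}^n(V)$ be the space of families $f=(f_{2p-1})_{p\ge1}$ of linear maps $f_{2p-1}:(V\otimes V)^{\otimes(p-1)}\otimes V\to V$ of degree $n+p-1$. Define linear maps $\Psi:\mathrm{CV}^n(V)\to \mathrm{CL}^n(s(V\otimes V))$ by $$(\Psi f)_p(sX_1,\dots,sX_{p-1},s(x\otimes y))=(-1)^{\frac{p(p-1)}2}s\Big(f_{2p-1}(X_1,\dots,X_{p-1},x)\otimes y+(-1)^{x(X_1+\cdots+X_{p-1}+n+p-1)}x\otimes f_{2p-1}(X_1,\dots,X_{p-1},y)\Big)$$ for homogeneous $X_i\in V\otimes V$ and $x,y\in V$, and a bracket on $\mathrm{CV}^\bullet(V)$ by $[\![f,g]\!]=\Psi^{-1}\big([\Psi f,\Psi g]_B\big)$. A homotopy Nambu algebra structure on $V$ is a $\pi=(\pi_{2k-1})_{k\ge1}\in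 \mathrm{CV}^1(V)$ (so $\pi_{2k-1}$ has degree $k$) with $[\![\pi,\pi]\!]=0$. **Statement.** The maps $\Psi$ are injective, the bracket $[\![\cdot,\cdot]\!]$ is well defined (that is, $[\Psi f,\Psi g]_B$ always lies in the image of $\Psi$), $(\mathrm{CV}^\bullet(V),[\![\cdot,\cdot]\!])$ and $(\mathrm{CL}^\bullet(s(V\otimes V)),[\cdot,\cdot]_B)$ are graded Lie algebras, and $\Psi$ is a homomorphism of graded Lie algebras between them. Consequently, for every homotopy Nambu algebra $(V,\{\pi_{2k-1}\}_{k\ge1})$, the element $\ell=\Psi(\pi)$ is a Leibniz$_\infty$-algebra structure on $s(V\otimes V)$. Explicitly, $\ell_i(sX_1,\dots,sX_i)=(-1)^{\frac{i(i-1)}2}\,s\,\varpi_i(X_1,\dots,X_i)$, where for homogeneous $X_1,\dots,X_{i-1}\in V\otimes V$ and homogeneous $x_i,y_i\in V$, with $X_i=x_i\otimes y_i$, $$\varpi_i(X_1,\dots,X_i)=\pi_{2i-1}(X_1,\dots,X_{i-1},x_i)\otimes y_i+(-1)^{x_i(X_1+\cdots+X_{i-1}+i)}\,x_i\otimes\pi_{2i-1}(X_1,\dots,X_{i-1},y_i).$$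 -/

import Mathlib

open scoped TensorProduct

noncomputable section

namespace HomotopyNambu

/-! ### Signs, graded vector spaces, tensor square and suspension -/

/-- The sign `(-1)^x`, for `x` an integer modulo `2`. -/
def psgn (x : ZMod 2) : ℤ := (-1) ^ x.val

variable {K A V : Type*} [Field K]
  [AddCommGroup A] [Module K A] [AddCommGroup V] [Module K V]

/-- For a `ℤ`-graded vector space `A = ⨁ 𝒜 i`, the projection of `A` onto the sum of the
components whose degree has parity `a`. -/
def parityProj (𝒜 : ℤ → Submodule K A) [DirectSum.Decomposition 𝒜] (a : ZMod 2) : A →ₗ[K] A :=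
  (DirectSum.toModule K ℤ A fun i : ℤ => if (i : ZMod 2) = a then (𝒜 i).subtype else 0) ∘ₗ
    (DirectSum.decomposeLinearEquiv 𝒜).toLinearMap

theorem parityProj_apply (𝒜 : ℤ → Submodule K A) [DirectSum.Decomposition 𝒜] (a : ZMod 2)
    {i : ℤ} {x : A} (hx : x ∈ 𝒜 i) :
    parityProj 𝒜 a x = if (i : ZMod 2) = a then x else 0 := by
  lift x to 𝒜 i using hx
  simp only [parityProj, LinearMap.comp_apply, LinearEquiv.coe_coe,
    DirectSum.decomposeLinearEquiv_apply_coe, DirectSum.toModule_lof]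
  split_ifs <;> simp

theorem parityProj_mem (𝒜 : ℤ → Submodule K A) [DirectSum.Decomposition 𝒜] (a : ZMod 2)
    {i : ℤ} {x : A} (hx : x ∈ 𝒜 i) : parityProj 𝒜 a x ∈ 𝒜 i := by
  rw [parityProj_apply 𝒜 a hx]
  split_ifs
  · exact hx
  · exact zero_mem _

/-- The linear map `x ↦ (-1)^(δ |x|) x`. -/
def parityTwist (𝒜 : ℤ → Submodule K A) [DirectSum.Decomposition 𝒜] (δ : ZMod 2) : A →ₗ[K] A :=
  parityProj 𝒜 0 + psgn δ • parityProj 𝒜 1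

theorem parityTwist_apply (𝒜 : ℤ → Submodule K A) [DirectSum.Decomposition 𝒜] (δ : ZMod 2)
    {i : ℤ} {x : A} (hx : x ∈ 𝒜 i) : parityTwist 𝒜 δ x = psgn (δ * i) • x := by
  have h : (i : ZMod 2) = 0 ∨ (i : ZMod 2) = 1 := by
    generalize (i : ZMod 2) = j
    revert j
    decide
  simp only [parityTwist, LinearMap.add_apply, LinearMap.smul_apply, parityProj_apply 𝒜 _ hx]
  rcases h with h | h <;> simp [h, psgn]

/-- The total grading of `V ⊗ V`: degree `n` is spanned by `x ⊗ y` with `|x| + |y| = n`. -/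
def tensorGrading (𝒱 : ℤ → Submodule K V) (n : ℤ) : Submodule K (V ⊗[K] V) :=
  ⨆ i : ℤ, Submodule.map₂ (TensorProduct.mk K V V) (𝒱 i) (𝒱 (n - i))

theorem tmul_mem (𝒱 : ℤ → Submodule K V) {i j : ℤ} {x y : V} (hx : x ∈ 𝒱 i) (hy : y ∈ 𝒱 j) :
    x ⊗ₜ[K] y ∈ tensorGrading 𝒱 (i + j) := by
  refine Submodule.mem_iSup_of_mem i (Submodule.apply_mem_map₂ (TensorProduct.mk K V V) hx ?_)
  simpa using hy

theorem tensorGrading_le (𝒱 : ℤ → Submodule K V) {n : ℤ} {P : Submodule K (V ⊗[K] V)}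
    (h : ∀ i j x y, i + j = n → x ∈ 𝒱 i → y ∈ 𝒱 j → x ⊗ₜ[K] y ∈ P) : tensorGrading 𝒱 n ≤ P := by
  refine iSup_le fun i => Submodule.map₂_le.2 fun x hx y hy => ?_
  exact h i (n - i) x y (by ring) hx hy

/-- The map `V ⊗ V → ⨁ (V ⊗ V)_n` that splits a tensor into its homogeneous components. -/
def tensorDecompose (𝒱 : ℤ → Submodule K V) [DirectSum.Decomposition 𝒱] :
    V ⊗[K] V →ₗ[K] DirectSum ℤ fun n => tensorGrading 𝒱 n :=
  (DirectSum.toModule K (ℤ × ℤ) _ fun p =>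
      DirectSum.lof K ℤ (fun n => tensorGrading 𝒱 n) (p.1 + p.2) ∘ₗ
        TensorProduct.lift (LinearMap.mk₂ K
          (fun (x : 𝒱 p.1) (y : 𝒱 p.2) =>
            (⟨x ⊗ₜ[K] y, tmul_mem 𝒱 x.2 y.2⟩ : tensorGrading 𝒱 (p.1 + p.2)))
          (fun _ _ _ => Subtype.ext (by simp [TensorProduct.add_tmul]))
          (fun _ _ _ => Subtype.ext (by simp [TensorProduct.smul_tmul']))
          (fun _ _ _ => Subtype.ext (by simp [TensorProduct.tmul_add]))
          (fun _ _ _ => Subtype.ext (by simp)))) ∘ₗ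
    (TensorProduct.directSum K K (fun i => 𝒱 i) (fun i => 𝒱 i)).toLinearMap ∘ₗ
    (TensorProduct.congr (DirectSum.decomposeLinearEquiv 𝒱)
      (DirectSum.decomposeLinearEquiv 𝒱)).toLinearMap

theorem tensorDecompose_tmul (𝒱 : ℤ → Submodule K V) [DirectSum.Decomposition 𝒱] {i j : ℤ}
    {x y : V} (hx : x ∈ 𝒱 i) (hy : y ∈ 𝒱 j) :
    tensorDecompose 𝒱 (x ⊗ₜ[K] y) =
      DirectSum.lof K ℤ (fun n => tensorGrading 𝒱 n) (i + j) ⟨x ⊗ₜ[K] y, tmul_mem 𝒱 hx hy⟩ := by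
  lift x to 𝒱 i using hx
  lift y to 𝒱 j using hy
  simp only [tensorDecompose, LinearMap.comp_apply, LinearEquiv.coe_coe,
    TensorProduct.congr_tmul, DirectSum.decomposeLinearEquiv_apply_coe,
    TensorProduct.directSum_lof_tmul_lof, DirectSum.toModule_lof, TensorProduct.lift.tmul,
    LinearMap.mk₂_apply]

instance (𝒱 : ℤ → Submodule K V) [DirectSum.Decomposition 𝒱] :
    DirectSum.Decomposition (tensorGrading 𝒱) :=
  DirectSum.Decomposition.ofLinearMap _ (tensorDecompose 𝒱)
    (by
      refine TensorProduct.ext' fun x y => ?_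
      induction x using DirectSum.Decomposition.inductionOn 𝒱 with
      | zero => simp
      | add x x' hx hx' => rw [TensorProduct.add_tmul, map_add, map_add, hx, hx']
      | homogeneous x =>
        induction y using DirectSum.Decomposition.inductionOn 𝒱 with
        | zero => simp
        | add y y' hy hy' => rw [TensorProduct.tmul_add, map_add, map_add, hy, hy']
        | homogeneous y =>
          rw [LinearMap.comp_apply, tensorDecompose_tmul 𝒱 x.2 y.2, DirectSum.coeLinearMap_lof]
          rfl)
    (by
      refine DirectSum.linearMap_ext _ fun n => LinearMap.ext fun z => ?_
      obtain ⟨z, hz⟩ := z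
      have key : tensorGrading 𝒱 n ≤ LinearMap.eqLocus (tensorDecompose 𝒱)
          (DirectSum.lof K ℤ (fun n => tensorGrading 𝒱 n) n ∘ₗ
            DirectSum.component K ℤ (fun n => tensorGrading 𝒱 n) n ∘ₗ tensorDecompose 𝒱) := by
        refine tensorGrading_le 𝒱 fun i j x y hij hx hy => ?_
        subst hij
        rw [LinearMap.mem_eqLocus, LinearMap.comp_apply, LinearMap.comp_apply,
          tensorDecompose_tmul 𝒱 hx hy, DirectSum.component.lof_self]
      have key2 : tensorGrading 𝒱 n ≤ LinearMap.eqLocus LinearMap.id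
          ((tensorGrading 𝒱 n).subtype ∘ₗ DirectSum.component K ℤ (fun n => tensorGrading 𝒱 n) n ∘ₗ
            tensorDecompose 𝒱) := by
        refine tensorGrading_le 𝒱 fun i j x y hij hx hy => ?_
        subst hij
        rw [LinearMap.mem_eqLocus, LinearMap.comp_apply, LinearMap.comp_apply,
          tensorDecompose_tmul 𝒱 hx hy, DirectSum.component.lof_self]
        rfl
      have h1 := key hz
      have h2 := key2 hz
      rw [LinearMap.mem_eqLocus] at h1 h2
      simp only [LinearMap.comp_apply, LinearMap.id_apply, DirectSum.coeLinearMap_lof,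
        Submodule.subtype_apply] at h1 h2 ⊢
      rw [h1]
      congr 1
      exact Subtype.ext h2.symm)

/-- The suspension `sA`, with `(sA)_n = A_(n-1)`. The map `s : A → sA` is the identity of the
underlying vector space, of degree `1`. -/
def shift (𝒜 : ℤ → Submodule K A) (n : ℤ) : Submodule K A := 𝒜 (n - 1)

instance (𝒜 : ℤ → Submodule K A) [DirectSum.Decomposition 𝒜] :
    DirectSum.Decomposition (shift 𝒜) :=
  DirectSum.Decomposition.ofLinearMap _
    ((DirectSum.toModule K ℤ (DirectSum ℤ fun n => shift 𝒜 n) fun i =>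
      DirectSum.lof K ℤ (fun n => shift 𝒜 n) (i + 1) ∘ₗ
        Submodule.inclusion (show 𝒜 i ≤ shift 𝒜 (i + 1) by simp [shift])) ∘ₗ
      (DirectSum.decomposeLinearEquiv 𝒜).toLinearMap)
    (by
      refine LinearMap.ext fun x => ?_
      induction x using DirectSum.Decomposition.inductionOn 𝒜 with
      | zero => simp
      | add x x' hx hx' => rw [map_add, map_add, hx, hx']
      | homogeneous x => simp)
    (by
      refine DirectSum.linearMap_ext _ fun n => LinearMap.ext fun z => ?_
      obtain ⟨i, rfl⟩ : ∃ i, n = i + 1 := ⟨n - 1, by ring⟩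
      obtain ⟨z, hz⟩ := z
      have hz' : z ∈ 𝒜 i := by simpa [shift] using hz
      have : DirectSum.decompose 𝒜 z = DirectSum.lof K ℤ (fun n => 𝒜 n) i ⟨z, hz'⟩ :=
        DirectSum.decompose_of_mem 𝒜 hz'
      simp only [LinearMap.comp_apply, DirectSum.coeLinearMap_lof, LinearEquiv.coe_coe,
        DirectSum.decomposeLinearEquiv_apply, this, DirectSum.toModule_lof, LinearMap.id_apply]
      rfl)

/-! ### Graded Lie algebras -/

/-- The graded vector space `⨁ L n` (given by subspaces of a common ambient space `M`, so that
elements of equal degrees can be compared) with a bracket of degree `0` is a graded Lie algebra. -/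
structure IsGradedLieAlgebra {M : Type*} [AddCommGroup M] [Module K M] (L : ℤ → Submodule K M)
    (br : ∀ m n : ℤ, L m → L n → L (m + n)) : Prop where
  add_left : ∀ m n (x x' : L m) (y : L n), br m n (x + x') y = br m n x y + br m n x' y
  add_right : ∀ m n (x : L m) (y y' : L n), br m n x (y + y') = br m n x y + br m n x y'
  smul_left : ∀ m n (c : K) (x : L m) (y : L n), br m n (c • x) y = c • br m n x y
  smul_right : ∀ m n (c : K) (x : L m) (y : L n), br m n x (c • y) = c • br m n x y
  skew : ∀ m n (x : L m) (y : L n),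
    (br m n x y : M) = -(psgn ((m * n : ℤ) : ZMod 2) • (br n m y x : M))
  jacobi : ∀ m n p (x : L m) (y : L n) (z : L p),
    (br m (n + p) x (br n p y z) : M) =
      (br (m + n) p (br m n x y) z : M) +
        psgn ((m * n : ℤ) : ZMod 2) • (br n (m + p) y (br m p x z) : M)

/-- The degree `0` linear maps `φ n : L n → L' n` form a homomorphism of graded Lie algebras. -/
structure IsGradedLieHom {M M' : Type*} [AddCommGroup M] [Module K M]
    [AddCommGroup M'] [Module K M'] (L : ℤ → Submodule K M) (L' : ℤ → Submodule K M')
    (br : ∀ m n : ℤ, L m → L n → L (m + n)) (br' : ∀ m n : ℤ, L' m → L' n → L' (m + n))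
    (φ : ∀ n : ℤ, L n →ₗ[K] L' n) : Prop where
  source : IsGradedLieAlgebra L br
  target : IsGradedLieAlgebra L' br'
  map_bracket : ∀ m n (x : L m) (y : L n), φ (m + n) (br m n x y) = br' m n (φ m x) (φ n y)

/-- Maurer-Cartan elements (the differential is zero). -/
def IsMaurerCartan {M : Type*} [AddCommGroup M] [Module K M] (L : ℤ → Submodule K M)
    (br : ∀ m n : ℤ, L m → L n → L (m + n)) (x : L 1) : Prop :=
  br 1 1 x x = 0

/-! ### The graded Balavoine algebra -/

/-- A family of linear maps `f a : A^{⊗(a+1)} → A`, one for each `a ≥ 0`. -/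
abbrev Family (K A : Type*) [Field K] [AddCommGroup A] [Module K A] : Type _ :=
  ∀ a : ℕ, MultilinearMap K (fun _ : Fin (a + 1) => A) A

/-- The space of degree `n` linear maps from the reduced tensor space
`⨁_{i ≥ 1} A^{⊗i}` to `A`. -/
def CL (𝒜 : ℤ → Submodule K A) (n : ℤ) : Submodule K (Family K A) where
  carrier := {f | ∀ (a : ℕ) (d : Fin (a + 1) → ℤ) (v : Fin (a + 1) → A),
    (∀ i, v i ∈ 𝒜 (d i)) → f a v ∈ 𝒜 ((∑ i, d i) + n)}
  zero_mem' := fun _ _ _ _ => zero_mem _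
  add_mem' := fun hf hg a d v hv => add_mem (hf a d v hv) (hg a d v hv)
  smul_mem' := fun c _ hf a d v hv => Submodule.smul_mem _ c (hf a d v hv)

/-- With indices starting from `0`, the list
`w_0, …, w_{c-1}, G(w_c, …, w_{c+b}), w_{c+b+1}, …, w_N` of `a + 1` elements, where `a + b = N`. -/
def insertArgs {a b c N : ℕ} (h : a + b = N) (hc : c ≤ a)
    (G : MultilinearMap K (fun _ : Fin (b + 1) => A) A) (w : Fin (N + 1) → A) (r : Fin (a + 1)) :
    A :=
  if (r : ℕ) < c then w ⟨r, by omega⟩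
  else if (r : ℕ) = c then G fun t => w ⟨c + t, by omega⟩
  else w ⟨r + b, by omega⟩

theorem insertArgs_update_cases {a b c N : ℕ} (h : a + b = N) (hc : c ≤ a)
    (G : MultilinearMap K (fun _ : Fin (b + 1) => A) A) (w : Fin (N + 1) → A) (p : Fin (N + 1)) :
    (∃ r : Fin (a + 1), ∀ x, insertArgs h hc G (Function.update w p x) =
      Function.update (insertArgs h hc G w) r x) ∨
    (∃ (r : Fin (a + 1)) (t : Fin (b + 1)), ∀ x, insertArgs h hc G (Function.update w p x) =
      Function.update (insertArgs h hc G w) r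
        (G (Function.update (fun t : Fin (b + 1) => w ⟨c + t, by omega⟩) t x))) := by
  obtain ⟨p, hp⟩ := p
  have hG : (p < c ∨ c + b < p) → ∀ x, (fun t : Fin (b + 1) =>
      Function.update w ⟨p, hp⟩ x ⟨c + t, by omega⟩) = fun t : Fin (b + 1) => w ⟨c + t, by omega⟩ := by
    intro h' x
    funext t
    rw [Function.update_of_ne]
    simp only [ne_eq, Fin.mk.injEq]
    omega
  rcases lt_or_ge p c with h1 | h1
  · refine Or.inl ⟨⟨p, by omega⟩, fun x => funext fun r => ?_⟩
    simp only [insertArgs, hG (Or.inl h1)]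
    simp only [Function.update_apply, Fin.ext_iff, insertArgs]
    split_ifs <;> first | rfl | omega
  · rcases lt_or_ge (c + b) p with h2 | h2
    · refine Or.inl ⟨⟨p - b, by omega⟩, fun x => funext fun r => ?_⟩
      simp only [insertArgs, hG (Or.inr h2)]
      simp only [Function.update_apply, Fin.ext_iff, insertArgs]
      split_ifs <;> first | rfl | omega
    · refine Or.inr ⟨⟨c, by omega⟩, ⟨p - c, by omega⟩, fun x => funext fun r => ?_⟩
      have hG' : (fun t : Fin (b + 1) => Function.update w ⟨p, hp⟩ x ⟨c + t, by omega⟩) =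
          Function.update (fun t : Fin (b + 1) => w ⟨c + t, by omega⟩) ⟨p - c, by omega⟩ x := by
        funext t
        simp only [Function.update_apply, Fin.ext_iff]
        split_ifs <;> first | rfl | omega
      simp only [insertArgs, hG']
      simp only [Function.update_apply, Fin.ext_iff, insertArgs]
      split_ifs <;> first | rfl | omega

/-- The map
`(w_0, …, w_N) ↦ F(w_0, …, w_{c-1}, G(w_c, …, w_{c+b}), w_{c+b+1}, …, w_N)`. -/
def insertAt {a b c N : ℕ} (h : a + b = N) (hc : c ≤ a)
    (F : MultilinearMap K (fun _ : Fin (a + 1) => A) A)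
    (G : MultilinearMap K (fun _ : Fin (b + 1) => A) A) :
    MultilinearMap K (fun _ : Fin (N + 1) => A) A :=
  MultilinearMap.mk' (fun w => F (insertArgs h hc G w))
    (fun w p x y => by
      rcases insertArgs_update_cases h hc G w p with ⟨r, hr⟩ | ⟨r, t, hr⟩
      · rw [hr, hr, hr, MultilinearMap.map_update_add]
      · rw [hr, hr, hr, MultilinearMap.map_update_add, MultilinearMap.map_update_add])
    (fun w p k x => by
      rcases insertArgs_update_cases h hc G w p with ⟨r, hr⟩ | ⟨r, t, hr⟩
      · rw [hr, hr, MultilinearMap.map_update_smul]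
      · rw [hr, hr, MultilinearMap.map_update_smul, MultilinearMap.map_update_smul])

theorem sum_insert {a b c N : ℕ} (h : a + b = N) (hc : c ≤ a) (d : Fin (N + 1) → ℤ) (n : ℤ) :
    (∑ r : Fin (a + 1), if (r : ℕ) < c then d ⟨r, by omega⟩
      else if (r : ℕ) = c then (∑ t : Fin (b + 1), d ⟨c + t, by omega⟩) + n
      else d ⟨r + b, by omega⟩) = (∑ i, d i) + n := by
  obtain ⟨D, hD⟩ : ∃ D : ℕ → ℤ, ∀ i (hi : i < N + 1), d ⟨i, hi⟩ = D i :=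
    ⟨fun i => if hi : i < N + 1 then d ⟨i, hi⟩ else 0, fun i hi => by simp [hi]⟩
  have h0 : ∑ i, d i = ∑ i ∈ Finset.range (N + 1), D i := by
    rw [← Fin.sum_univ_eq_sum_range]
    exact Finset.sum_congr rfl fun i _ => hD i i.2
  rw [h0]
  simp only [hD]
  rw [Fin.sum_univ_eq_sum_range (fun t => D (c + t)) (b + 1),
    Fin.sum_univ_eq_sum_range (fun r => if r < c then D r else if r = c then
      (∑ t ∈ Finset.range (b + 1), D (c + t)) + n else D (r + b)) (a + 1)]
  obtain ⟨k, rfl⟩ := Nat.exists_eq_add_of_le hc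
  subst h
  rw [show c + k + 1 = c + (1 + k) by ring, show c + k + b + 1 = c + (b + 1 + k) by ring,
    Finset.sum_range_add _ c, Finset.sum_range_add _ 1, Finset.sum_range_add _ c,
    Finset.sum_range_add _ (b + 1) k,
    Finset.sum_congr rfl fun x hx => if_pos (Finset.mem_range.1 hx)]
  have h3 : ∀ x ∈ Finset.range k, (if c + (1 + x) < c then D (c + (1 + x)) else
      if c + (1 + x) = c then (∑ t ∈ Finset.range (b + 1), D (c + t)) + n
      else D (c + (1 + x) + b)) = D (c + (b + 1 + x)) := fun x _ => by
    rw [if_neg (by omega), if_neg (by omega)]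
    congr 1
    ring
  rw [Finset.sum_congr rfl h3]
  simp only [Finset.sum_range_one, add_zero, lt_self_iff_false, if_false, if_true]
  ring

theorem insertAt_mem (𝒜 : ℤ → Submodule K A) {m n : ℤ} {a b c N : ℕ} (h : a + b = N) (hc : c ≤ a)
    {F : MultilinearMap K (fun _ : Fin (a + 1) => A) A}
    {G : MultilinearMap K (fun _ : Fin (b + 1) => A) A}
    (hF : ∀ (d : Fin (a + 1) → ℤ) (v : Fin (a + 1) → A),
      (∀ i, v i ∈ 𝒜 (d i)) → F v ∈ 𝒜 ((∑ i, d i) + m))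
    (hG : ∀ (d : Fin (b + 1) → ℤ) (v : Fin (b + 1) → A),
      (∀ i, v i ∈ 𝒜 (d i)) → G v ∈ 𝒜 ((∑ i, d i) + n))
    (d : Fin (N + 1) → ℤ) (w : Fin (N + 1) → A) (hw : ∀ i, w i ∈ 𝒜 (d i)) :
    insertAt h hc F G w ∈ 𝒜 ((∑ i, d i) + (m + n)) := by
  have := hF (v := insertArgs h hc G w) (d := fun r : Fin (a + 1) => if (r : ℕ) < c then
      d ⟨r, by omega⟩ else if (r : ℕ) = c then (∑ t : Fin (b + 1), d ⟨c + t, by omega⟩) + n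
      else d ⟨r + b, by omega⟩) (fun r => by
    simp only [insertArgs]
    split_ifs
    · exact hw _
    · exact hG _ _ fun t => hw _
    · exact hw _)
  rw [sum_insert h hc d n] at this
  rwa [add_assoc, add_comm n m] at this

/-- The `(c, b)`-shuffles, as permutations of `{0, …, N}` that fix all `p ≥ c + b`. -/
def shuffles (c b N : ℕ) : Finset (Equiv.Perm (Fin (N + 1))) :=
  Finset.univ.filter fun σ =>
    (∀ p q : Fin (N + 1), p < q → (q : ℕ) < c → σ p < σ q) ∧
    (∀ p q : Fin (N + 1), c ≤ (p : ℕ) → p < q → (q : ℕ) < c + b → σ p < σ q) ∧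
    (∀ p : Fin (N + 1), c + b ≤ (p : ℕ) → σ p = p)

/-- The exponent of the Koszul sign `ε(σ; v_0, …, v_N)` that arises when `v_0 ⋯ v_N` is reordered
into `v_{σ(0)} ⋯ v_{σ(N)}`, where `v_i` has parity `d i`. -/
def koszulExp {N : ℕ} (σ : Equiv.Perm (Fin N)) (d : Fin N → ZMod 2) : ZMod 2 :=
  ∑ p : Fin N, ∑ q : Fin N, if p < q ∧ σ q < σ p then d (σ p) * d (σ q) else 0

theorem sum_parityProj {B ι : Type*} [AddCommGroup B] [Module K B] [Fintype ι] [DecidableEq ι]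
    (𝒜 : ℤ → Submodule K A) [DirectSum.Decomposition 𝒜] (M : (ι → ZMod 2) →
    MultilinearMap K (fun _ : ι => A) B) (e : ι → ℤ) (v : ι → A) (hv : ∀ i, v i ∈ 𝒜 (e i)) :
    ∑ d : ι → ZMod 2, M d (fun i => parityProj 𝒜 (d i) (v i)) =
      M (fun i => (e i : ZMod 2)) v := by
  rw [Finset.sum_eq_single (fun i => (e i : ZMod 2))]
  · congr 1
    funext i
    simp [parityProj_apply 𝒜 _ (hv i)]
  · intro d _ hd
    obtain ⟨i, hi⟩ := Function.ne_iff.1 hd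
    refine (M d).map_coord_zero i ?_
    rw [parityProj_apply 𝒜 _ (hv i), if_neg hi.symm]
  · simp

/-- The operation `F ∘_{c+1} G`, where `G` has degree `n`. The sum over `d` splits the arguments
into their parity components. On homogeneous arguments `v_i` this is
`∑_σ (-1)^β ε(σ) F(v_{σ(0)}, …, v_{σ(c-1)}, G(v_{σ(c)}, …, v_{σ(c+b-1)}, v_{c+b}), v_{c+b+1}, …, v_N)`
with `σ` running over the `(c, b)`-shuffles and `β = n (|v_{σ(0)}| + ⋯ + |v_{σ(c-1)}|)`. -/
def circAt (𝒜 : ℤ → Submodule K A) [DirectSum.Decomposition 𝒜] (n : ℤ) {a b c N : ℕ}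
    (h : a + b = N) (hc : c ≤ a)
    (F : MultilinearMap K (fun _ : Fin (a + 1) => A) A)
    (G : MultilinearMap K (fun _ : Fin (b + 1) => A) A) :
    MultilinearMap K (fun _ : Fin (N + 1) => A) A :=
  ∑ σ ∈ shuffles c b N, ∑ d : Fin (N + 1) → ZMod 2,
    psgn (koszulExp σ d + n * ∑ p : Fin (N + 1), if (p : ℕ) < c then d (σ p) else 0) •
      ((insertAt h hc F G).domDomCongr σ).compLinearMap fun i => parityProj 𝒜 (d i)

theorem circAt_apply (𝒜 : ℤ → Submodule K A) [DirectSum.Decomposition 𝒜] (n : ℤ) {a b c N : ℕ}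
    (h : a + b = N) (hc : c ≤ a)
    (F : MultilinearMap K (fun _ : Fin (a + 1) => A) A)
    (G : MultilinearMap K (fun _ : Fin (b + 1) => A) A)
    (e : Fin (N + 1) → ℤ) (v : Fin (N + 1) → A) (hv : ∀ i, v i ∈ 𝒜 (e i)) :
    circAt 𝒜 n h hc F G v = ∑ σ ∈ shuffles c b N,
      psgn (koszulExp σ (fun i => (e i : ZMod 2)) +
        n * ∑ p : Fin (N + 1), if (p : ℕ) < c then (e (σ p) : ZMod 2) else 0) •
      insertAt h hc F G fun i => v (σ i) := by
  simp only [circAt, sum_apply]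
  refine Finset.sum_congr rfl fun σ _ => ?_
  exact sum_parityProj 𝒜 (fun d => psgn (koszulExp σ d + n * ∑ p : Fin (N + 1),
    if (p : ℕ) < c then d (σ p) else 0) • (insertAt h hc F G).domDomCongr σ) e v hv

/-- The composition `f ∘̄ g`, where `g` has degree `n`: its component of arity `N + 1` is the sum of
all `f_i ∘_k g_j` with `i + j = N + 2` and `1 ≤ k ≤ i`. -/
def circ (𝒜 : ℤ → Submodule K A) [DirectSum.Decomposition 𝒜] (n : ℤ) (f g : Family K A) :
    Family K A := fun N =>
  ∑ p ∈ (Finset.HasAntidiagonal.antidiagonal N).attach, ∑ c : Fin (p.1.1 + 1),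
    circAt 𝒜 n (Finset.HasAntidiagonal.mem_antidiagonal.1 p.2) (Nat.lt_succ_iff.1 c.2) (f p.1.1) (g p.1.2)

theorem circ_mem (𝒜 : ℤ → Submodule K A) [DirectSum.Decomposition 𝒜] {m n : ℤ}
    {f g : Family K A} (hf : f ∈ CL 𝒜 m) (hg : g ∈ CL 𝒜 n) : circ 𝒜 n f g ∈ CL 𝒜 (m + n) := by
  intro N d v hv
  simp only [circ, sum_apply]
  refine sum_mem fun p _ => sum_mem fun c _ => ?_
  rw [circAt_apply 𝒜 n _ _ _ _ d v hv]
  refine sum_mem fun σ _ => zsmul_mem ?_ _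
  rw [← Equiv.sum_comp σ d]
  exact insertAt_mem 𝒜 _ _ (hf _) (hg _) _ _ fun i => hv _

/-- The graded Balavoine bracket `[f, g] = f ∘̄ g - (-1)^(mn) g ∘̄ f`. -/
def balavoineBracket (𝒜 : ℤ → Submodule K A) [DirectSum.Decomposition 𝒜] (m n : ℤ)
    (f : CL 𝒜 m) (g : CL 𝒜 n) : CL 𝒜 (m + n) :=
  ⟨circ 𝒜 n f g - psgn ((m * n : ℤ) : ZMod 2) • circ 𝒜 m g f,
    sub_mem (circ_mem 𝒜 f.2 g.2)
      (zsmul_mem (add_comm n m ▸ circ_mem 𝒜 g.2 f.2) _)⟩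

/-- A Leibniz-infinity-algebra structure on the graded vector space `A`: a collection of linear
maps `ℓ k : A^{⊗(k+1)} → A` of degree `1` that is a Maurer-Cartan element of the graded Balavoine
algebra. -/
def IsLeibnizInfinity (𝒜 : ℤ → Submodule K A) [DirectSum.Decomposition 𝒜] (ℓ : CL 𝒜 1) : Prop :=
  IsMaurerCartan (CL 𝒜) (balavoineBracket 𝒜) ℓ

/-! ### Homotopy Nambu algebras -/

/-- A family of linear maps `f a : (V ⊗ V)^{⊗a} ⊗ V → V`, one for each `a ≥ 0` (the last argument
is curried). The map `f a` is the component that takes `2a + 1` arguments from `V`. -/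
abbrev NambuFamily (K V : Type*) [Field K] [AddCommGroup V] [Module K V] : Type _ :=
  ∀ a : ℕ, MultilinearMap K (fun _ : Fin a => V ⊗[K] V) (V →ₗ[K] V)

/-- The families for which `f a : (V ⊗ V)^{⊗a} ⊗ V → V` has degree `n + a`. -/
def CV (𝒱 : ℤ → Submodule K V) (n : ℤ) : Submodule K (NambuFamily K V) where
  carrier := {f | ∀ (a : ℕ) (d : Fin a → ℤ) (e : ℤ) (X : Fin a → V ⊗[K] V) (x : V),
    (∀ i, X i ∈ tensorGrading 𝒱 (d i)) → x ∈ 𝒱 e → f a X x ∈ 𝒱 ((∑ i, d i) + e + (n + a))}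
  zero_mem' := fun _ _ _ _ _ _ _ => zero_mem _
  add_mem' := fun hf hg a d e X x hX hx => add_mem (hf a d e X x hX hx) (hg a d e X x hX hx)
  smul_mem' := fun c _ hf a d e X x hX hx => Submodule.smul_mem _ c (hf a d e X x hX hx)

/-- The map `(V ⊗ V)^{⊗(a+1)} → V ⊗ V` attached to `F : (V ⊗ V)^{⊗a} ⊗ V → V` of degree `n + a`:
on homogeneous arguments,
`(X_1, …, X_a, x ⊗ y) ↦ F(X_1, …, X_a, x) ⊗ y + (-1)^(|x|(|X_1| + ⋯ + |X_a| + n + a)) x ⊗ F(X_1, …, X_a, y)`. -/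
def leibnizExt (𝒱 : ℤ → Submodule K V) [DirectSum.Decomposition 𝒱] (n : ℤ) (a : ℕ)
    (F : MultilinearMap K (fun _ : Fin a => V ⊗[K] V) (V →ₗ[K] V)) :
    MultilinearMap K (fun _ : Fin (a + 1) => V ⊗[K] V) (V ⊗[K] V) :=
  MultilinearMap.uncurryRight
    ((LinearMap.rTensorHom V).compMultilinearMap F +
      ∑ d : Fin a → ZMod 2,
        (TensorProduct.mapBilinear (RingHom.id K) V V V V
          (parityTwist 𝒱 ((∑ i, d i) + n + a))).compMultilinearMap
          (F.compLinearMap fun i => parityProj (tensorGrading 𝒱) (d i)))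

/-- Homogeneous arguments are evaluated by the expected formula. -/
theorem leibnizExt_apply (𝒱 : ℤ → Submodule K V) [DirectSum.Decomposition 𝒱] (n : ℤ) (a : ℕ)
    (F : MultilinearMap K (fun _ : Fin a => V ⊗[K] V) (V →ₗ[K] V)) (d : Fin a → ℤ) (e : ℤ)
    (X : Fin a → V ⊗[K] V) (x y : V) (hX : ∀ i, X i ∈ tensorGrading 𝒱 (d i)) (hx : x ∈ 𝒱 e) :
    leibnizExt 𝒱 n a F (Fin.snoc X (x ⊗ₜ[K] y)) =
      F X x ⊗ₜ[K] y + psgn ((e * ((∑ i, d i) + n + a) : ℤ) : ZMod 2) • (x ⊗ₜ[K] F X y) := by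
  have key := sum_parityProj (tensorGrading 𝒱)
    (fun d : Fin a → ZMod 2 => ((LinearMap.applyₗ (R := K) (x ⊗ₜ[K] y)) ∘ₗ
      TensorProduct.mapBilinear (RingHom.id K) V V V V
        (parityTwist 𝒱 ((∑ i, d i) + n + a))).compMultilinearMap F) d X hX
  simp only [LinearMap.compMultilinearMap_apply, LinearMap.comp_apply, LinearMap.applyₗ_apply_apply,
    TensorProduct.mapBilinear_apply, TensorProduct.map_tmul, parityTwist_apply 𝒱 _ hx] at key
  simp only [leibnizExt, MultilinearMap.uncurryRight_apply, Fin.init_snoc, Fin.snoc_last,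
    add_apply, LinearMap.add_apply, sum_apply, LinearMap.sum_apply,
    LinearMap.compMultilinearMap_apply, MultilinearMap.compLinearMap_apply,
    TensorProduct.mapBilinear_apply, TensorProduct.map_tmul, parityTwist_apply 𝒱 _ hx,
    LinearMap.coe_rTensorHom, LinearMap.rTensor_tmul]
  rw [key, TensorProduct.smul_tmul']
  push_cast
  rw [mul_comm]

theorem leibnizExt_add (𝒱 : ℤ → Submodule K V) [DirectSum.Decomposition 𝒱] (n : ℤ) (a : ℕ)
    (F G : MultilinearMap K (fun _ : Fin a => V ⊗[K] V) (V →ₗ[K] V)) :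
    leibnizExt 𝒱 n a (F + G) = leibnizExt 𝒱 n a F + leibnizExt 𝒱 n a G := by
  ext v
  simp only [leibnizExt, MultilinearMap.uncurryRight_apply, add_apply,
    LinearMap.add_apply, sum_apply, LinearMap.sum_apply,
    LinearMap.compMultilinearMap_apply, MultilinearMap.compLinearMap_apply, map_add,
    Finset.sum_add_distrib]
  abel

theorem leibnizExt_smul (𝒱 : ℤ → Submodule K V) [DirectSum.Decomposition 𝒱] (n : ℤ) (a : ℕ)
    (c : K) (F : MultilinearMap K (fun _ : Fin a => V ⊗[K] V) (V →ₗ[K] V)) :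
    leibnizExt 𝒱 n a (c • F) = c • leibnizExt 𝒱 n a F := by
  ext v
  simp only [leibnizExt, MultilinearMap.uncurryRight_apply, add_apply,
    LinearMap.add_apply, sum_apply, LinearMap.sum_apply,
    LinearMap.compMultilinearMap_apply, MultilinearMap.compLinearMap_apply, map_smul,
    smul_apply, LinearMap.smul_apply, Finset.smul_sum, smul_add]

theorem leibnizExt_mem (𝒱 : ℤ → Submodule K V) [DirectSum.Decomposition 𝒱] {n : ℤ}
    {f : NambuFamily K V} (hf : f ∈ CV 𝒱 n) :
    (fun a => (-1 : ℤ) ^ ((a + 1) * a / 2) • leibnizExt 𝒱 n a (f a)) ∈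
      CL (shift (tensorGrading 𝒱)) n := by
  intro a d v hv
  refine zsmul_mem ?_ _
  obtain ⟨X, w, rfl⟩ : ∃ (X : Fin a → V ⊗[K] V) (w : V ⊗[K] V),
      v = (Fin.snoc X w : Fin (a + 1) → V ⊗[K] V) :=
    ⟨Fin.init v, v (Fin.last a), (Fin.snoc_init_self v).symm⟩
  have hX : ∀ i, X i ∈ tensorGrading 𝒱 (d i.castSucc - 1) := fun i => by
    simpa [shift] using hv i.castSucc
  have hw : w ∈ tensorGrading 𝒱 (d (Fin.last a) - 1) := by
    simpa [shift] using hv (Fin.last a)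
  have hle : tensorGrading 𝒱 (d (Fin.last a) - 1) ≤
      (shift (tensorGrading 𝒱) ((∑ i, d i) + n)).comap
        ((leibnizExt 𝒱 n a (f a)).curryRight X) := by
    refine tensorGrading_le 𝒱 fun i j x y hij hx hy => ?_
    have hs : ∑ k : Fin a, (d k.castSucc - 1) = (∑ k, d k) - d (Fin.last a) - a := by
      rw [Fin.sum_univ_castSucc d, Finset.sum_sub_distrib]
      simp
    rw [Submodule.mem_comap, MultilinearMap.curryRight_apply,
      leibnizExt_apply 𝒱 n a (f a) _ i X x y hX hx, shift]
    have h1 := tmul_mem 𝒱 (hf a _ _ X x hX hx) hy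
    have h2 := tmul_mem 𝒱 hx (hf a _ _ X y hX hy)
    rw [hs] at h1 h2
    rw [show (∑ k, d k) - d (Fin.last a) - a + i + (n + a) + j = (∑ k, d k) + n - 1 by
      linear_combination hij] at h1
    rw [show i + ((∑ k, d k) - d (Fin.last a) - a + j + (n + a)) = (∑ k, d k) + n - 1 by
      linear_combination hij] at h2
    exact add_mem h1 (zsmul_mem h2 _)
  exact hle hw

/-- The map `Ψ` from `CV^n(V, V)` to `CL^n(s(V ⊗ V), s(V ⊗ V))`. On its `p`-th component,
`p = a + 1`, it is `(-1)^(p(p-1)/2)` times the extension above; the suspension `s` is the identity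
of the underlying vector space. -/
def Psi (𝒱 : ℤ → Submodule K V) [DirectSum.Decomposition 𝒱] (n : ℤ) :
    CV 𝒱 n →ₗ[K] CL (shift (tensorGrading 𝒱)) n where
  toFun f := ⟨fun a => (-1 : ℤ) ^ ((a + 1) * a / 2) • leibnizExt 𝒱 n a (f.1 a),
    leibnizExt_mem 𝒱 f.2⟩
  map_add' f g := Subtype.ext <| funext fun a => by
    simp only [Submodule.coe_add, Pi.add_apply, leibnizExt_add, smul_add]
  map_smul' c f := Subtype.ext <| funext fun a => by
    simp only [Submodule.coe_smul, Pi.smul_apply, leibnizExt_smul, RingHom.id_apply]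
    rw [smul_comm]

/-- The bracket `⟦f, g⟧ = Ψ⁻¹([Ψ f, Ψ g])` on `CV`. -/
def nambuBracket (𝒱 : ℤ → Submodule K V) [DirectSum.Decomposition 𝒱] (m n : ℤ)
    (f : CV 𝒱 m) (g : CV 𝒱 n) : CV 𝒱 (m + n) :=
  Function.invFun (Psi 𝒱 (m + n))
    (balavoineBracket (shift (tensorGrading 𝒱)) m n (Psi 𝒱 m f) (Psi 𝒱 n g))

/-- A homotopy Nambu algebra structure on `V`: a collection of linear maps
`π k : (V ⊗ V)^{⊗k} ⊗ V → V` of degree `k + 1` that is a Maurer-Cartan element. -/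
def IsHomotopyNambu (𝒱 : ℤ → Submodule K V) [DirectSum.Decomposition 𝒱] (π : CV 𝒱 1) : Prop :=
  IsMaurerCartan (CV 𝒱) (nambuBracket 𝒱) π

end HomotopyNambu
end

/-! Everything rests on a recursion in the first argument. For `x` homogeneous of degree `i`, write
`cur x f` for `f (x, -)` and `lin f` for the component of arity one. If `g` has degree `n`, then
`cur x (f ∘̄ g) = cur (lin g x) f + (-1)^(n i) (cur x f) ∘̄ g + f ∘̄ (cur x g)`, where `cur x g`
counts as an operation of degree `n + i` (`cur_circ`). The three terms record the place of the first
argument in a shuffle: as the only argument of `g` with nothing before `g`, at the head of the block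
before `g`, or at the head of the shuffled block inside `g`. Together with `lin (f ∘̄ g) = lin f ∘
lin g` (`lin_circ`), this determines `∘̄`, so identities can be proved by induction on the arity
without returning to shuffles.

One such identity says that the associator of `∘̄` is graded symmetric in its last two entries
(`associator_symm`): `∘̄` is a graded right pre-Lie product. Its graded commutator, the Balavoine
bracket, is therefore a graded Lie bracket.

The image of `Psi` consists of the families that, once all arguments but the last are fixed and
homogeneous, are derivations of `V ⊗ V` extending a homogeneous endomorphism of `V`
(`psi_mem_derivationFamilies`, `exists_psi_eq`). Graded commutators of such derivations are again of
this kind, and the recursion carries this over to the Balavoine bracket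
(`derivationFamilies_bracket`). In characteristic other than two an endomorphism of definite parity
is recovered from its derivation (`eq_zero_of_derExt_eq_zero`), so `Psi` is injective. The bracket
on `CV` is thus a genuine preimage, and the Lie axioms and Maurer-Cartan elements pass through
`Psi`. -/

namespace HomotopyNambu

/-! ### Recursion for shuffles and Koszul signs -/

/-- The permutation that sends `j` to `0` and `j.succAbove p` to `(σ p).succ`. -/
def insPerm {N : ℕ} (j : Fin (N + 1)) (σ : Equiv.Perm (Fin N)) : Equiv.Perm (Fin (N + 1)) :=
  ((finSuccEquiv' j).trans (Equiv.optionCongr σ)).trans (finSuccEquiv' 0).symm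

@[simp]
theorem insPerm_self {N : ℕ} (j : Fin (N + 1)) (σ : Equiv.Perm (Fin N)) : insPerm j σ j = 0 := by
  simp [insPerm]

@[simp]
theorem insPerm_succAbove {N : ℕ} (j : Fin (N + 1)) (σ : Equiv.Perm (Fin N)) (p : Fin N) :
    insPerm j σ (j.succAbove p) = (σ p).succ := by
  simp [insPerm]

@[simp]
theorem insPerm_zero_succ {N : ℕ} (σ : Equiv.Perm (Fin N)) (p : Fin N) :
    insPerm 0 σ p.succ = (σ p).succ := by
  simpa using insPerm_succAbove 0 σ p

theorem insPerm_bijective (N : ℕ) : Function.Bijective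
    fun x : Fin (N + 1) × Equiv.Perm (Fin N) => insPerm x.1 x.2 := by
  rw [Fintype.bijective_iff_injective_and_card]
  constructor
  · rintro ⟨j, σ⟩ ⟨j', σ'⟩ h
    have h : insPerm j σ = insPerm j' σ' := h
    obtain rfl : j = j' := (insPerm j' σ').injective (by rw [insPerm_self, ← h, insPerm_self])
    refine Prod.ext rfl (Equiv.ext fun p => ?_)
    have := congrArg (fun τ => τ (j.succAbove p)) h
    simpa using this
  · simp [Fintype.card_perm, Nat.factorial_succ]

theorem sum_perm_succ {M : Type*} [AddCommMonoid M] {N : ℕ}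
    (t : Equiv.Perm (Fin (N + 1)) → M) : ∑ σ, t σ = ∑ j, ∑ σ, t (insPerm j σ) := by
  rw [← Fintype.sum_prod_type' fun j σ => t (insPerm j σ)]
  exact ((insPerm_bijective N).sum_comp t).symm

/-- Since `0` is the least index, its inversions are exactly with the `j` entries placed before it:
`v_0` has to pass each of them. -/
theorem koszulExp_insPerm {N : ℕ} (j : Fin (N + 1)) (σ : Equiv.Perm (Fin N))
    (d : Fin (N + 1) → ZMod 2) :
    koszulExp (insPerm j σ) d =
      d 0 * (∑ p : Fin N, if (p : ℕ) < j then d (σ p).succ else 0) +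
        koszulExp σ fun i => d i.succ := by
  have h : ∀ p : Fin N, j.succAbove p < j ↔ (p : ℕ) < j := fun p => by
    rw [Fin.succAbove_lt_iff_castSucc_lt, Fin.lt_def, Fin.val_castSucc]
  simp only [koszulExp, Fin.sum_univ_succAbove _ j, insPerm_self, insPerm_succAbove, lt_self_iff_false,
    Fin.not_lt_zero, and_false, if_false, Finset.sum_const_zero, zero_add, Fin.succ_pos, and_true, h,
    Fin.succAbove_lt_succAbove_iff, Fin.succ_lt_succ_iff, Finset.sum_add_distrib, Finset.mul_sum,
    mul_ite, mul_zero]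
  simp only [mul_comm]

theorem succAbove_val {N : ℕ} (j : Fin (N + 1)) (p : Fin N) :
    (j.succAbove p : ℕ) = if (p : ℕ) < j then (p : ℕ) else p + 1 := by
  rw [Fin.succAbove]
  simp only [Fin.lt_def, Fin.val_castSucc]
  split_ifs <;> simp

theorem insPerm_mem_shuffles_zero {c b N : ℕ} (σ : Equiv.Perm (Fin (N + 1))) :
    insPerm 0 σ ∈ shuffles (c + 1) b (N + 1) ↔ σ ∈ shuffles c b N := by
  simp only [shuffles, Finset.mem_filter, Finset.mem_univ, true_and, Fin.forall_fin_succ (n := N + 1),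
    insPerm_self, insPerm_zero_succ, Fin.val_succ, Fin.succ_lt_succ_iff, Fin.val_zero,
    Fin.succ_pos, Fin.not_lt_zero, lt_self_iff_false, Fin.succ_inj,
    show c + 1 + b = (c + b) + 1 by ring, Nat.succ_lt_succ_iff, Nat.succ_le_succ_iff]
  simp

/-- Positions before `c` are unchanged and later ones move up by one. The values also move up by
one, so the fixed tail stays fixed, and the value `0` at position `c` is a legitimate head of the
second block. -/
theorem insPerm_mem_shuffles_self {c b N : ℕ} (hc : c < N + 2) (σ : Equiv.Perm (Fin (N + 1))) :
    insPerm ⟨c, hc⟩ σ ∈ shuffles c (b + 1) (N + 1) ↔ σ ∈ shuffles c b N := by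
  have hlt : ∀ p : Fin (N + 1), (p : ℕ) < c → ((Fin.succAbove ⟨c, hc⟩ p : Fin (N + 2)) : ℕ) = p :=
    fun p hp => by rw [succAbove_val, if_pos hp]
  have hge : ∀ p : Fin (N + 1), c ≤ (p : ℕ) →
      ((Fin.succAbove ⟨c, hc⟩ p : Fin (N + 2)) : ℕ) = p + 1 :=
    fun p hp => by rw [succAbove_val, if_neg (not_lt.2 hp)]
  simp only [shuffles, Finset.mem_filter, Finset.mem_univ, true_and]
  constructor
  · rintro ⟨h1, h2, h3⟩
    refine ⟨fun p q hpq hq => ?_, fun p q hp hpq hq => ?_, fun p hp => ?_⟩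
    · have := h1 (Fin.succAbove ⟨c, hc⟩ p) (Fin.succAbove ⟨c, hc⟩ q)
        (Fin.succAbove_lt_succAbove_iff.2 hpq) (by rwa [hlt q hq])
      simpa using this
    · have hpq' := Fin.lt_def.1 hpq
      have := h2 (Fin.succAbove ⟨c, hc⟩ p) (Fin.succAbove ⟨c, hc⟩ q)
        (by rw [hge p hp]; omega) (Fin.succAbove_lt_succAbove_iff.2 hpq)
        (by rw [hge q (by omega)]; omega)
      simpa using this
    · have := h3 (Fin.succAbove ⟨c, hc⟩ p) (by rw [hge p (by omega)]; omega)
      rw [insPerm_succAbove, Fin.ext_iff, hge p (by omega), Fin.val_succ] at this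
      exact Fin.ext (by omega)
  · rintro ⟨h1, h2, h3⟩
    have hv := succAbove_val (⟨c, hc⟩ : Fin (N + 2))
    refine ⟨fun p q hpq hq => ?_, fun p q hp hpq hq => ?_, fun p hp => ?_⟩
    · have hpq' := Fin.lt_def.1 hpq
      obtain ⟨p, rfl⟩ := (Fin.eq_self_or_eq_succAbove ⟨c, hc⟩ p).resolve_left
        fun h => by simp only [Fin.ext_iff] at h; omega
      obtain ⟨q, rfl⟩ := (Fin.eq_self_or_eq_succAbove ⟨c, hc⟩ q).resolve_left
        fun h => by simp only [Fin.ext_iff] at h; omega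
      rw [insPerm_succAbove, insPerm_succAbove, Fin.succ_lt_succ_iff]
      rw [hv q] at hq
      refine h1 p q (Fin.succAbove_lt_succAbove_iff.1 hpq) ?_
      split_ifs at hq <;> omega
    · have hpq' := Fin.lt_def.1 hpq
      obtain ⟨q, rfl⟩ := (Fin.eq_self_or_eq_succAbove ⟨c, hc⟩ q).resolve_left
        fun h => by simp only [Fin.ext_iff] at h; omega
      rcases Fin.eq_self_or_eq_succAbove ⟨c, hc⟩ p with rfl | ⟨p, rfl⟩
      · simp
      rw [insPerm_succAbove, insPerm_succAbove, Fin.succ_lt_succ_iff]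
      rw [hv] at hp hq
      refine h2 p q ?_ (Fin.succAbove_lt_succAbove_iff.1 hpq) ?_
      · split_ifs at hp <;> simp only at * <;> omega
      · split_ifs at hq <;> simp only at * <;> omega
    · obtain ⟨p, rfl⟩ := (Fin.eq_self_or_eq_succAbove ⟨c, hc⟩ p).resolve_left
        fun h => by simp only [Fin.ext_iff] at h; omega
      have hp' : c + b ≤ (p : ℕ) := by
        rw [hv] at hp
        split_ifs at hp <;> simp only at * <;> omega
      rw [insPerm_succAbove, h3 p hp', Fin.ext_iff, hge p (by omega), Fin.val_succ]

/-- The least value can only stand at the head of an increasing block. It cannot lie in the fixed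
tail, which does not contain position `0` when `c + b` is positive. -/
theorem insPerm_mem_shuffles {c b N : ℕ} (h : 0 < c + b) (j : Fin (N + 2))
    (σ : Equiv.Perm (Fin (N + 1)))
    (hσ : insPerm j σ ∈ shuffles c b (N + 1)) : (j = 0 ∧ 0 < c) ∨ ((j : ℕ) = c ∧ 0 < b) := by
  simp only [shuffles, Finset.mem_filter, Finset.mem_univ, true_and] at hσ
  obtain ⟨h1, h2, h3⟩ := hσ
  rcases lt_or_ge (j : ℕ) c with hj | hj
  · refine Or.inl ⟨?_, by omega⟩
    by_contra h0
    simpa using h1 0 j (Fin.pos_of_ne_zero h0) hj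
  rcases lt_or_ge (j : ℕ) (c + b) with hj' | hj'
  · refine Or.inr ⟨?_, by omega⟩
    by_contra h0
    simpa using h2 ⟨c, by omega⟩ j le_rfl (Fin.lt_def.2 (by simp; omega)) hj'
  · have := h3 j hj'
    rw [insPerm_self, Fin.ext_iff, Fin.val_zero] at this
    omega

theorem shuffles_zero_zero (N : ℕ) : shuffles 0 0 N = {1} := by
  ext σ
  simp [shuffles, Equiv.ext_iff]

/-- The analogue of Pascal's rule for shuffles, sorted by the block that contains the value `0`. -/
theorem sum_shuffles_succ {M : Type*} [AddCommMonoid M] {c b N : ℕ} (hc : c < N + 2)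
    (h : 0 < c + b) (t : Equiv.Perm (Fin (N + 2)) → M) :
    ∑ σ ∈ shuffles c b (N + 1), t σ =
      (if 0 < c then ∑ σ ∈ shuffles (c - 1) b N, t (insPerm 0 σ) else 0) +
        if 0 < b then ∑ σ ∈ shuffles c (b - 1) N, t (insPerm ⟨c, hc⟩ σ) else 0 := by
  classical
  have key : ∀ (j : Fin (N + 2)) (σ : Equiv.Perm (Fin (N + 1))),
      (if insPerm j σ ∈ shuffles c b (N + 1) then t (insPerm j σ) else 0) =
        (if 0 = j then if 0 < c then if σ ∈ shuffles (c - 1) b N then t (insPerm 0 σ) else 0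
          else 0 else 0) +
        (if ⟨c, hc⟩ = j then if 0 < b then if σ ∈ shuffles c (b - 1) N then
          t (insPerm ⟨c, hc⟩ σ) else 0 else 0 else 0) := by
    intro j σ
    have h1 : 0 < c → (insPerm 0 σ ∈ shuffles c b (N + 1) ↔ σ ∈ shuffles (c - 1) b N) := by
      intro hc0
      obtain ⟨c, rfl⟩ := Nat.exists_eq_succ_of_ne_zero hc0.ne'
      exact insPerm_mem_shuffles_zero σ
    have h2 : 0 < b → (insPerm ⟨c, hc⟩ σ ∈ shuffles c b (N + 1) ↔ σ ∈ shuffles c (b - 1) N) := by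
      intro hb0
      obtain ⟨b, rfl⟩ := Nat.exists_eq_succ_of_ne_zero hb0.ne'
      exact insPerm_mem_shuffles_self hc σ
    have h3 := insPerm_mem_shuffles h j σ
    by_cases hj0 : 0 = j
    · subst hj0
      by_cases hc0 : 0 < c
      · have : ¬ ((⟨c, hc⟩ : Fin (N + 2)) = 0) := by simp [Fin.ext_iff]; omega
        simp [hc0, h1, this]
      -- The two candidate positions coincide here; the guard `0 < c` removes the first summand, so
      -- nothing is counted twice.
      · obtain rfl : c = 0 := by omega
        simp only [Fin.zero_eta] at h2 ⊢
        have hb : 0 < b := by omega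
        simp [hb, h2]
    · by_cases hjc : (⟨c, hc⟩ : Fin (N + 2)) = j
      · subst hjc
        by_cases hb : 0 < b
        · simp [hj0, hb, h2]
        · rw [if_neg fun h => ?_]
          · simp [hj0, hb]
          · rcases h3 h with ⟨h, -⟩ | ⟨-, h⟩
            · exact hj0 h.symm
            · exact hb h
      · rw [if_neg fun h => ?_]
        · simp [hj0, hjc]
        · rcases h3 h with ⟨h, -⟩ | ⟨h, -⟩
          · exact hj0 h.symm
          · exact hjc (Fin.ext h.symm)
  rw [← Finset.univ_inter (shuffles c b (N + 1)), ← Finset.sum_ite_mem,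
    sum_perm_succ]
  simp only [key, Finset.sum_add_distrib]
  rw [Finset.sum_comm, Finset.sum_comm (γ := Fin (N + 2))]
  simp only [Finset.sum_ite_eq, Finset.mem_univ, if_true]
  congr 1 <;> split_ifs <;> simp

/-! ### Fixing the first argument of an inserted operation -/

variable {K A : Type*} [Field K] [AddCommGroup A] [Module K A]

/-- The family `w ↦ f (x, w)`. -/
def cur : A →ₗ[K] Family K A →ₗ[K] Family K A :=
  LinearMap.mk₂ K (fun x f k => (f (k + 1)).curryLeft x)
    (fun x y f => funext fun k => map_add (f (k + 1)).curryLeft x y)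
    (fun c x f => funext fun k => map_smul (f (k + 1)).curryLeft c x)
    (fun _ _ _ => rfl) (fun _ _ _ => rfl)

theorem cur_apply (x : A) (f : Family K A) (k : ℕ) (w : Fin (k + 1) → A) :
    cur x f k w = f (k + 1) (Fin.cons x w) := rfl

/-- The component of arity one. -/
def lin : Family K A →ₗ[K] A →ₗ[K] A where
  toFun f := (MultilinearMap.ofSubsingletonₗ K K A A (0 : Fin 1)).symm (f 0)
  map_add' f g := map_add (MultilinearMap.ofSubsingletonₗ K K A A (0 : Fin 1)).symm (f 0) (g 0)
  map_smul' c f := map_smul (MultilinearMap.ofSubsingletonₗ K K A A (0 : Fin 1)).symm c (f 0)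

theorem lin_apply (f : Family K A) (x : A) : lin f x = f 0 fun _ => x := rfl

theorem insertAt_apply {a b c N : ℕ} (h : a + b = N) (hc : c ≤ a)
    (F : MultilinearMap K (fun _ : Fin (a + 1) => A) A)
    (G : MultilinearMap K (fun _ : Fin (b + 1) => A) A) (w : Fin (N + 1) → A) :
    insertAt h hc F G w = F (insertArgs h hc G w) := rfl

/-- The inner operation always has one unshuffled last argument. With both blocks empty that
argument is `x` itself. -/
theorem insertAt_zero_zero (f g : Family K A) {N : ℕ} (h : N + 1 + 0 = N + 1) (x : A)
    (w : Fin (N + 1) → A) :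
    insertAt h (Nat.zero_le _) (f (N + 1)) (g 0) (Fin.cons x w : Fin (N + 2) → A) =
      cur (lin g x) f N w := by
  rw [insertAt_apply, cur_apply]
  congr 1
  funext r
  refine Fin.cases ?_ (fun r => ?_) r
  · simp only [insertArgs, Fin.val_zero, lt_self_iff_false, if_false, if_true, Fin.cons_zero,
      lin_apply]
    congr 1
    funext t
    obtain rfl : t = 0 := Fin.ext (by omega)
    rfl
  · simp [insertArgs]
    rfl

theorem insertAt_insPerm_zero (f g : Family K A) {a b c N : ℕ} (h : a + b = N) (hc : c ≤ a)
    (x : A) (w : Fin (N + 1) → A) (σ : Equiv.Perm (Fin (N + 1))) :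
    (insertAt (show a + 1 + b = N + 1 by omega) (Nat.succ_le_succ hc) (f (a + 1)) (g b)
      fun i => (Fin.cons x w : Fin (N + 2) → A) (insPerm 0 σ i)) =
      insertAt h hc (cur x f a) (g b) fun i => w (σ i) := by
  rw [insertAt_apply, insertAt_apply, cur_apply]
  congr 1
  have hx : ∀ (k : ℕ) (hk : k + 1 < N + 2), (Fin.cons x w : Fin (N + 2) → A)
      (insPerm 0 σ ⟨k + 1, hk⟩) = w (σ ⟨k, by omega⟩) := fun k hk => by
    rw [← Fin.succ_mk, insPerm_zero_succ, Fin.cons_succ]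
  funext r
  refine Fin.cases ?_ (fun r => ?_) r
  · simp [insertArgs]
  · simp only [insertArgs, Fin.cons_succ, Fin.val_succ, Nat.succ_lt_succ_iff, Nat.succ_inj,
      show ∀ k, (r : ℕ) + 1 + k = (r + k) + 1 by intro; ring,
      show ∀ k, c + 1 + k = (c + k) + 1 by intro; ring, hx]

theorem insertAt_insPerm_self (f g : Family K A) {a b c N : ℕ} (h : a + b = N) (hc : c ≤ a)
    (x : A) (w : Fin (N + 1) → A) (σ : Equiv.Perm (Fin (N + 1))) :
    (insertAt (show a + (b + 1) = N + 1 by omega) hc (f a) (g (b + 1))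
      fun i => (Fin.cons x w : Fin (N + 2) → A) (insPerm ⟨c, by omega⟩ σ i)) =
      insertAt h hc (f a) (cur x g b) fun i => w (σ i) := by
  rw [insertAt_apply, insertAt_apply]
  congr 1
  have hlt : ∀ (k : ℕ) (hk : k < N + 2) (hk' : k < c), (Fin.cons x w : Fin (N + 2) → A)
      (insPerm ⟨c, by omega⟩ σ ⟨k, hk⟩) = w (σ ⟨k, by omega⟩) := fun k hk hk' => by
    have : (⟨k, hk⟩ : Fin (N + 2)) = Fin.succAbove ⟨c, by omega⟩ ⟨k, by omega⟩ :=
      Fin.ext (by rw [succAbove_val, if_pos hk'])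
    rw [this, insPerm_succAbove, Fin.cons_succ]
  have hge : ∀ (k : ℕ) (hk : k + 1 < N + 2) (hk' : c ≤ k), (Fin.cons x w : Fin (N + 2) → A)
      (insPerm ⟨c, by omega⟩ σ ⟨k + 1, hk⟩) = w (σ ⟨k, by omega⟩) := fun k hk hk' => by
    have : (⟨k + 1, hk⟩ : Fin (N + 2)) = Fin.succAbove ⟨c, by omega⟩ ⟨k, by omega⟩ :=
      Fin.ext (by rw [succAbove_val, if_neg (by simpa using hk')])
    rw [this, insPerm_succAbove, Fin.cons_succ]
  funext r
  simp only [insertArgs]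
  split_ifs with h1 h2
  · exact hlt _ _ h1
  · rw [cur_apply]
    congr 1
    funext t
    refine Fin.cases ?_ (fun t => ?_) t
    · simp
    · rw [Fin.cons_succ, ← hge _ (by omega) (by omega)]
      rfl
  · exact hge (r + b) _ (by omega)

end HomotopyNambu

/-! ### The recursion for the composition in the first argument -/

namespace HomotopyNambu

theorem psgn_add (x y : ZMod 2) : psgn (x + y) = psgn x * psgn y := by
  revert x y
  decide

variable {K A : Type*} [Field K] [AddCommGroup A] [Module K A]
  (𝒜 : ℤ → Submodule K A) [DirectSum.Decomposition 𝒜]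

theorem linearMap_ext_homogeneous {B : Type*} [AddCommGroup B] [Module K B] {F G : A →ₗ[K] B}
    (h : ∀ i, ∀ x ∈ 𝒜 i, F x = G x) : F = G := by
  ext x
  induction x using DirectSum.Decomposition.inductionOn 𝒜 with
  | zero => simp
  | add x y hx hy => rw [map_add, map_add, hx, hy]
  | homogeneous x => exact h _ x x.2

theorem multilinearMap_ext_homogeneous {B : Type*} [AddCommGroup B] [Module K B] {N : ℕ}
    {F G : MultilinearMap K (fun _ : Fin N => A) B}
    (h : ∀ (d : Fin N → ℤ) (v : Fin N → A), (∀ i, v i ∈ 𝒜 (d i)) → F v = G v) : F = G := by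
  induction N with
  | zero => exact MultilinearMap.ext fun v => h (fun _ => 0) v fun i => i.elim0
  | succ N ih =>
    rw [← F.uncurry_curryLeft, ← G.uncurry_curryLeft]
    congr 1
    refine linearMap_ext_homogeneous 𝒜 fun i x hx => ih fun d v hv => ?_
    refine h (Fin.cons i d) (Fin.cons x v) fun j => ?_
    refine Fin.cases ?_ (fun j => ?_) j
    · simpa using hx
    · simpa using hv j

theorem component_succ_ext {f g : Family K A} {N : ℕ}
    (h : ∀ i, ∀ x ∈ 𝒜 i, cur x f N = cur x g N) : f (N + 1) = g (N + 1) := by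
  rw [← (f (N + 1)).uncurry_curryLeft, ← (g (N + 1)).uncurry_curryLeft]
  congr 1
  exact linearMap_ext_homogeneous 𝒜 h

theorem component_zero_ext {f g : Family K A} (h : lin f = lin g) : f 0 = g 0 :=
  (MultilinearMap.ofSubsingletonₗ K K A A (0 : Fin 1)).symm.injective h

/-- The summand of `circ` with given arities and position. -/
def circTerm (n : ℤ) (f g : Family K A) (N a b c : ℕ) :
    MultilinearMap K (fun _ : Fin (N + 1) => A) A :=
  if h : a + b = N ∧ c ≤ a then circAt 𝒜 n h.1 h.2 (f a) (g b) else 0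

/-- In `circTerm` the indices are free natural numbers, with value zero out of range, so the sum can
be reindexed without carrying proofs of `a + b = N` and `c ≤ a`. -/
theorem circ_eq_sum (n : ℤ) (f g : Family K A) (N : ℕ) :
    circ 𝒜 n f g N = ∑ p ∈ Finset.HasAntidiagonal.antidiagonal N, ∑ c ∈ Finset.range (p.1 + 1),
      circTerm 𝒜 n f g N p.1 p.2 c := by
  rw [circ, ← Finset.sum_attach (Finset.HasAntidiagonal.antidiagonal N)]
  refine Finset.sum_congr rfl fun p _ => ?_
  rw [← Fin.sum_univ_eq_sum_range]
  refine Finset.sum_congr rfl fun c _ => ?_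
  rw [circTerm, dif_pos ⟨Finset.HasAntidiagonal.mem_antidiagonal.1 p.2, Nat.lt_succ_iff.1 c.2⟩]

/-- The signs decide the shape of the formula. At the head of the first block `x` costs no Koszul
sign but contributes `n * i`, because `g` passes it. At the head of the second block it passes the
first block; this Koszul sign combines with that of `g` into the sign belonging to an inner
operation of degree `n + i`, namely `cur x g`. -/
theorem circTerm_cons (n : ℤ) (f g : Family K A) {N a b c : ℕ} (h : a + b = N + 1) (hc : c ≤ a)
    {i : ℤ} {x : A} (hx : x ∈ 𝒜 i) (d : Fin (N + 1) → ℤ) (w : Fin (N + 1) → A)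
    (hw : ∀ j, w j ∈ 𝒜 (d j)) :
    circTerm 𝒜 n f g (N + 1) a b c (Fin.cons x w : Fin (N + 2) → A) =
      (if 0 < c then psgn (n * i : ℤ) • circTerm 𝒜 n (cur x f) g N (a - 1) b (c - 1) w else 0) +
      (if 0 < b then circTerm 𝒜 (n + i) f (cur x g) N a (b - 1) c w else 0) +
      (if c = 0 ∧ b = 0 then cur (lin g x) f N w else 0) := by
  have hv : ∀ j, (Fin.cons x w : Fin (N + 2) → A) j ∈ 𝒜 ((Fin.cons i d : Fin (N + 2) → ℤ) j) := by
    intro j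
    refine Fin.cases ?_ (fun j => ?_) j
    · simpa using hx
    · simpa using hw j
  rw [circTerm, dif_pos ⟨h, hc⟩, circAt_apply 𝒜 n _ _ _ _ _ _ hv]
  rcases Nat.eq_zero_or_pos (c + b) with h0 | h0
  · obtain ⟨rfl, rfl⟩ : c = 0 ∧ b = 0 := by omega
    obtain rfl : a = N + 1 := by omega
    rw [shuffles_zero_zero, Finset.sum_singleton]
    have := insertAt_zero_zero f g h x w
    simp only [Equiv.Perm.coe_one, id_eq] at this ⊢
    rw [this]
    have hk : ∀ p q : Fin (N + 1 + 1), ¬ (p < q ∧ q < p) := fun p q h => lt_asymm h.1 h.2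
    simp [koszulExp, hk, psgn]
  · rw [sum_shuffles_succ (show c < N + 2 by omega) h0, if_neg (show ¬ (c = 0 ∧ b = 0) by omega),
      add_zero]
    congr 1
    · split_ifs with hc0
      swap
      · rfl
      obtain ⟨c, rfl⟩ := Nat.exists_eq_succ_of_ne_zero hc0.ne'
      obtain ⟨a, rfl⟩ := Nat.exists_eq_succ_of_ne_zero (show a ≠ 0 by omega)
      have h' : a + b = N ∧ c ≤ a := by omega
      simp only [Nat.succ_eq_add_one, Nat.add_sub_cancel]
      rw [circTerm, dif_pos h', circAt_apply 𝒜 n _ _ _ _ _ _ hw, Finset.smul_sum]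
      refine Finset.sum_congr rfl fun σ _ => ?_
      rw [insertAt_insPerm_zero f g h'.1 h'.2 x w σ, smul_smul, ← psgn_add]
      congr 2
      have e1 : (∑ p : Fin (N + 2), if (p : ℕ) < c + 1 then
          (((Fin.cons i d : Fin (N + 2) → ℤ) (insPerm 0 σ p) : ℤ) : ZMod 2) else 0) =
          i + ∑ p : Fin (N + 1), if (p : ℕ) < c then (d (σ p) : ZMod 2) else 0 := by
        rw [Fin.sum_univ_succ]
        simp
      rw [koszulExp_insPerm, e1]
      simp only [Fin.val_zero, Nat.not_lt_zero, if_false, Finset.sum_const_zero, mul_zero,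
        Fin.cons_succ]
      push_cast
      ring
    · split_ifs with hb0
      swap
      · rfl
      obtain ⟨b, rfl⟩ := Nat.exists_eq_succ_of_ne_zero hb0.ne'
      have h' : a + b = N ∧ c ≤ a := by omega
      simp only [Nat.succ_eq_add_one, Nat.add_sub_cancel]
      rw [circTerm, dif_pos h', circAt_apply 𝒜 (n + i) _ _ _ _ _ _ hw]
      refine Finset.sum_congr rfl fun σ _ => ?_
      rw [insertAt_insPerm_self f g h'.1 h'.2 x w σ]
      congr 2
      have e1 : (∑ p : Fin (N + 2), if (p : ℕ) < c then
          (((Fin.cons i d : Fin (N + 2) → ℤ) (insPerm ⟨c, by omega⟩ σ p) : ℤ) : ZMod 2) else 0) =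
          ∑ p : Fin (N + 1), if (p : ℕ) < c then (d (σ p) : ZMod 2) else 0 := by
        rw [Fin.sum_univ_succAbove _ ⟨c, by omega⟩, if_neg (lt_irrefl c), zero_add]
        refine Finset.sum_congr rfl fun p _ => if_congr ?_ (by rw [insPerm_succAbove, Fin.cons_succ]) rfl
        rw [succAbove_val]
        simp only
        split_ifs <;> omega
      rw [koszulExp_insPerm, e1]
      simp only [Fin.cons_zero, Fin.cons_succ]
      push_cast
      ring

theorem lin_circ (n : ℤ) (f g : Family K A) : lin (circ 𝒜 n f g) = lin f ∘ₗ lin g := by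
  refine linearMap_ext_homogeneous 𝒜 fun i x hx => ?_
  rw [lin_apply, circ_eq_sum]
  simp only [Finset.Nat.antidiagonal_zero, Finset.sum_singleton, zero_add, Finset.sum_range_one]
  rw [circTerm, dif_pos ⟨rfl, le_rfl⟩, circAt_apply 𝒜 n _ _ _ _ (fun _ => i) _ fun _ => hx,
    shuffles_zero_zero, Finset.sum_singleton]
  simp only [insertAt_apply, LinearMap.comp_apply, lin_apply]
  have hk : ∀ p q : Fin (0 + 1), ¬ (p < q ∧ q < p) := fun p q h => lt_asymm h.1 h.2
  simp only [koszulExp, Equiv.Perm.coe_one, id_eq, hk, if_false, Finset.sum_const_zero,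
    Nat.not_lt_zero, mul_zero, add_zero]
  rw [show psgn 0 = 1 from rfl, one_smul]
  congr 1
  funext r
  simp [insertArgs]

theorem cur_circ (n : ℤ) (f g : Family K A) {i : ℤ} {x : A} (hx : x ∈ 𝒜 i) :
    cur x (circ 𝒜 n f g) = cur (lin g x) f + psgn (n * i : ℤ) • circ 𝒜 n (cur x f) g +
      circ 𝒜 (n + i) f (cur x g) := by
  funext N
  refine multilinearMap_ext_homogeneous 𝒜 fun d w hw => ?_
  rw [cur_apply, circ_eq_sum]
  simp only [Pi.add_apply, Pi.smul_apply, add_apply, smul_apply,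
    circ_eq_sum, sum_apply]
  rw [Finset.sum_congr rfl fun p hp => Finset.sum_congr rfl fun c hc =>
    circTerm_cons 𝒜 n f g (Finset.HasAntidiagonal.mem_antidiagonal.1 hp)
      (Nat.lt_succ_iff.1 (Finset.mem_range.1 hc)) hx d w hw]
  simp only [Finset.sum_add_distrib]
  -- The three reindexings lower `(a, c)` by one, lower `b` by one, and isolate `(a, b, c) = (N + 1,
  -- 0, 0)`; the guards kill exactly the boundary terms that have no predecessor.
  have h1 : ∀ T : ℕ → ℕ → ℕ → A, (∑ p ∈ Finset.HasAntidiagonal.antidiagonal (N + 1),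
      ∑ c ∈ Finset.range (p.1 + 1),
      if 0 < c then T (p.1 - 1) p.2 (c - 1) else 0) =
      ∑ p ∈ Finset.HasAntidiagonal.antidiagonal N, ∑ c ∈ Finset.range (p.1 + 1), T p.1 p.2 c := fun T => by
    rw [Finset.Nat.sum_antidiagonal_succ]
    simp [Finset.sum_range_succ' _ (_ + 1)]
  have h2 : ∀ T : ℕ → ℕ → ℕ → A, (∑ p ∈ Finset.HasAntidiagonal.antidiagonal (N + 1),
      ∑ c ∈ Finset.range (p.1 + 1),
      if 0 < p.2 then T p.1 (p.2 - 1) c else 0) =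
      ∑ p ∈ Finset.HasAntidiagonal.antidiagonal N, ∑ c ∈ Finset.range (p.1 + 1), T p.1 p.2 c := fun T => by
    rw [Finset.Nat.sum_antidiagonal_succ']
    simp
  have h3 : ∀ z : A, (∑ p ∈ Finset.HasAntidiagonal.antidiagonal (N + 1),
      ∑ c ∈ Finset.range (p.1 + 1),
      if c = 0 ∧ p.2 = 0 then z else 0) = z := fun z => by
    rw [Finset.Nat.sum_antidiagonal_succ']
    simp
  rw [h1 fun a b c => psgn (n * i : ℤ) • circTerm 𝒜 n (cur x f) g N a b c w,
    h2 fun a b c => circTerm 𝒜 (n + i) f (cur x g) N a b c w, h3]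
  simp only [Finset.smul_sum]
  abel

end HomotopyNambu

/-! ### The pre-Lie identity and the graded Lie algebra of Balavoine -/

namespace HomotopyNambu

variable {K A : Type*} [Field K] [AddCommGroup A] [Module K A]

theorem psgn_eq_one_or (x : ZMod 2) : psgn x = 1 ∨ psgn x = -1 := by
  revert x
  decide

section Degrees

variable {𝒜 : ℤ → Submodule K A}

theorem cur_mem {m i : ℤ} {f : Family K A} (hf : f ∈ CL 𝒜 m) {x : A} (hx : x ∈ 𝒜 i) :
    cur x f ∈ CL 𝒜 (m + i) := by
  intro a d v hv
  have := hf (a + 1) (Fin.cons i d) (Fin.cons x v) fun j => by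
    refine Fin.cases ?_ (fun j => ?_) j
    · simpa using hx
    · simpa using hv j
  rw [Fin.sum_cons, show i + ∑ j, d j + m = ∑ j, d j + (m + i) by ring] at this
  exact this

theorem lin_mem {m i : ℤ} {f : Family K A} (hf : f ∈ CL 𝒜 m) {x : A} (hx : x ∈ 𝒜 i) :
    lin f x ∈ 𝒜 (i + m) := by
  simpa [lin_apply] using hf 0 (fun _ => i) (fun _ => x) fun _ => hx

end Degrees

variable (𝒜 : ℤ → Submodule K A) [DirectSum.Decomposition 𝒜]

/-- The composition `circ` as a bilinear map. -/
def circBilin (n : ℤ) : Family K A →ₗ[K] Family K A →ₗ[K] Family K A :=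
  LinearMap.mk₂ K (circ 𝒜 n)
    (fun f f' g => funext fun N => by
      -- The recursion replaces `n` by `n + i` and the families by their `cur x`, hence the
      -- generalization. The same induction yields all four linearity laws.
      induction N generalizing n f f' g with
      | zero => exact component_zero_ext (by simp [map_add lin, lin_circ, LinearMap.add_comp])
      | succ N ih =>
        refine component_succ_ext 𝒜 fun i x hx => ?_
        simp only [map_add, cur_circ 𝒜 _ _ _ hx, Pi.add_apply, Pi.smul_apply, ih, smul_add]
        abel)
    (fun c f g => funext fun N => by
      induction N generalizing n f g with
      | zero => exact component_zero_ext (by simp [map_smul lin, lin_circ, LinearMap.smul_comp])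
      | succ N ih =>
        refine component_succ_ext 𝒜 fun i x hx => ?_
        simp only [map_smul, cur_circ 𝒜 _ _ _ hx, Pi.add_apply, Pi.smul_apply, ih, smul_add,
          smul_comm c])
    (fun f g g' => funext fun N => by
      induction N generalizing n f g g' with
      | zero => exact component_zero_ext (by simp [map_add lin, lin_circ, LinearMap.comp_add])
      | succ N ih =>
        refine component_succ_ext 𝒜 fun i x hx => ?_
        simp only [map_add, cur_circ 𝒜 _ _ _ hx, Pi.add_apply, Pi.smul_apply, ih, smul_add,
          LinearMap.add_apply]
        abel)
    (fun c f g => funext fun N => by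
      induction N generalizing n f g with
      | zero => exact component_zero_ext (by simp [map_smul lin, lin_circ, LinearMap.comp_smul])
      | succ N ih =>
        refine component_succ_ext 𝒜 fun i x hx => ?_
        simp only [map_smul, cur_circ 𝒜 _ _ _ hx, Pi.add_apply, Pi.smul_apply, ih, smul_add,
          LinearMap.smul_apply, smul_comm c])

theorem lin_circBilin (n : ℤ) (f g : Family K A) : lin (circBilin 𝒜 n f g) = lin f ∘ₗ lin g :=
  lin_circ 𝒜 n f g

theorem cur_circBilin (n : ℤ) (f g : Family K A) {i : ℤ} {x : A} (hx : x ∈ 𝒜 i) :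
    cur x (circBilin 𝒜 n f g) = cur (lin g x) f + psgn (n * i : ℤ) • circBilin 𝒜 n (cur x f) g +
      circBilin 𝒜 (n + i) f (cur x g) :=
  cur_circ 𝒜 n f g hx

/-- The associator of `f`, `g`, `h`, where `g` and `h` have degrees `n` and `p`. -/
def associator (n p : ℤ) (f g h : Family K A) : Family K A :=
  circBilin 𝒜 p (circBilin 𝒜 n f g) h - circBilin 𝒜 (n + p) f (circBilin 𝒜 p g h)

/-- When both composites are expanded, the terms `cur (lin g (lin h x)) f` and `f ∘̄ cur (lin h x)
g` cancel. The degree of `h` matters because the recursion is also applied at `lin h x`, which must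
be homogeneous of degree `i + p`. -/
theorem cur_associator {n p : ℤ} (f g : Family K A) {h : Family K A} (hh : h ∈ CL 𝒜 p)
    {i : ℤ} {x : A} (hx : x ∈ 𝒜 i) :
    cur x (associator 𝒜 n p f g h) =
      psgn (n * (i + p) : ℤ) • circBilin 𝒜 n (cur (lin h x) f) g +
      psgn (p * i : ℤ) • circBilin 𝒜 p (cur (lin g x) f) h +
      psgn ((n + p) * i : ℤ) • associator 𝒜 n p (cur x f) g h +
      psgn (p * i : ℤ) • associator 𝒜 (n + i) p f (cur x g) h +
      associator 𝒜 n (p + i) f g (cur x h) := by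
  have e1 : n + i + p = n + p + i := by ring
  have e2 : n + (p + i) = n + p + i := by ring
  have e3 : n + (i + p) = n + p + i := by ring
  have e4 : psgn ((n + p) * i : ℤ) = psgn (n * i : ℤ) * psgn (p * i : ℤ) := by
    rw [← psgn_add]; push_cast; ring_nf
  simp only [associator, map_sub, map_add, map_zsmul, cur_circBilin 𝒜 _ _ _ hx, LinearMap.add_apply,
    LinearMap.smul_apply, lin_circBilin, LinearMap.comp_apply,
    cur_circBilin 𝒜 _ _ _ (lin_mem hh hx), e1, e2, e3, e4]
  module

/-- In arity one the associator vanishes, composition of linear maps being associative. In the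
recursion, the first two terms are exchanged by swapping `g` and `h`, and the other three are
associators of lower arity. -/
theorem associator_symm {n p : ℤ} (f : Family K A) {g h : Family K A} (hg : g ∈ CL 𝒜 n)
    (hh : h ∈ CL 𝒜 p) :
    associator 𝒜 n p f g h = psgn (n * p : ℤ) • associator 𝒜 p n f h g := by
  funext N
  induction N generalizing n p f g h with
  | zero =>
    refine component_zero_ext ?_
    simp [associator, map_sub, map_zsmul, lin_circBilin, LinearMap.comp_assoc]
  | succ N ih =>
    refine component_succ_ext 𝒜 fun i x hx => ?_
    rw [map_zsmul, cur_associator 𝒜 f g hh hx, cur_associator 𝒜 f h hg hx]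
    simp only [Pi.add_apply, Pi.smul_apply]
    rw [ih (cur x f) hg hh, ih f (cur_mem hg hx) hh, ih f hg (cur_mem hh hx)]
    simp only [Pi.smul_apply]
    push_cast
    simp only [mul_add, add_mul, psgn_add, mul_comm (i : ZMod 2), mul_comm (p : ZMod 2) n]
    -- Every sign is now a product of three basic ones; for each choice of their values the identity
    -- is linear.
    rcases psgn_eq_one_or (n * p) with h1 | h1 <;> rcases psgn_eq_one_or (n * i) with h2 | h2 <;>
    rcases psgn_eq_one_or (p * i) with h3 | h3 <;> rw [h1, h2, h3] <;> module

theorem balavoineBracket_coe (m n : ℤ) (f : CL 𝒜 m) (g : CL 𝒜 n) :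
    (balavoineBracket 𝒜 m n f g : Family K A) =
      circBilin 𝒜 n f g - psgn ((m * n : ℤ) : ZMod 2) • circBilin 𝒜 m g f := rfl

/-- The graded Jacobi identity is a signed sum of three instances of `associator_symm`, one for each
element placed in the outer position. -/
theorem balavoine_isGradedLieAlgebra : IsGradedLieAlgebra (CL 𝒜) (balavoineBracket 𝒜) where
  add_left m n x x' y := Subtype.ext <| by
    simp only [balavoineBracket_coe, Submodule.coe_add, map_add, LinearMap.add_apply, smul_add]
    abel
  add_right m n x y y' := Subtype.ext <| by
    simp only [balavoineBracket_coe, Submodule.coe_add, map_add, LinearMap.add_apply, smul_add]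
    abel
  smul_left m n c x y := Subtype.ext <| by
    simp only [balavoineBracket_coe, Submodule.coe_smul, map_smul, LinearMap.smul_apply, smul_sub,
      smul_comm c]
  smul_right m n c x y := Subtype.ext <| by
    simp only [balavoineBracket_coe, Submodule.coe_smul, map_smul, LinearMap.smul_apply, smul_sub,
      smul_comm c]
  skew m n x y := by
    simp only [balavoineBracket_coe]
    rw [mul_comm n m]
    rcases psgn_eq_one_or (m * n : ℤ) with h | h <;> rw [h] <;> module
  jacobi m n p x y z := by
    have h1 := associator_symm 𝒜 (x : Family K A) y.2 z.2
    have h2 := associator_symm 𝒜 (y : Family K A) x.2 z.2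
    have h3 := associator_symm 𝒜 (z : Family K A) x.2 y.2
    simp only [balavoineBracket_coe, associator, map_sub, map_zsmul, LinearMap.sub_apply,
      LinearMap.smul_apply] at *
    rw [add_comm n m] at *
    rw [add_comm p n] at *
    rw [add_comm p m] at *
    push_cast at *
    simp only [mul_add, add_mul, psgn_add] at *
    rw [mul_comm (n : ZMod 2) m] at *
    -- These signs are the coefficients with which the symmetries for `y` and `z` in the outer
    -- position enter the Jacobi identity.
    have h2' := congrArg (psgn (m * n) • ·) h2
    have h3' := congrArg ((psgn (m * p) * psgn (n * p)) • ·) h3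
    rcases psgn_eq_one_or (m * n) with s1 | s1 <;> rcases psgn_eq_one_or (m * p) with s2 | s2 <;>
    rcases psgn_eq_one_or (n * p) with s3 | s3 <;> simp only [s1, s2, s3] at h1 h2' h3' ⊢ <;>
    linear_combination (norm := module) h2' - h1 - h3'

end HomotopyNambu

/-! ### Derivations of the tensor square -/

namespace HomotopyNambu

variable {K V : Type*} [Field K] [AddCommGroup V] [Module K V]
  (𝒱 : ℤ → Submodule K V) [DirectSum.Decomposition 𝒱]

/-- The homogeneous endomorphisms of degree `t`. -/
def homDeg (𝒱 : ℤ → Submodule K V) (t : ℤ) : Submodule K (V →ₗ[K] V) where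
  carrier := {T | ∀ i, ∀ x ∈ 𝒱 i, T x ∈ 𝒱 (i + t)}
  zero_mem' := fun _ _ _ => zero_mem _
  add_mem' := fun hT hS i x hx => add_mem (hT i x hx) (hS i x hx)
  smul_mem' := fun c _ hT i x hx => Submodule.smul_mem _ c (hT i x hx)

/-- The endomorphisms of parity `q`. -/
def homParity (q : ZMod 2) : Submodule K (V →ₗ[K] V) where
  carrier := {T | ∀ i : ℤ, ∀ x ∈ 𝒱 i, parityProj 𝒱 (i + q) (T x) = T x}
  zero_mem' := fun _ _ _ => by simp
  add_mem' := fun hT hS i x hx => by rw [LinearMap.add_apply, map_add, hT i x hx, hS i x hx]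
  smul_mem' := fun c _ hT i x hx => by rw [LinearMap.smul_apply, map_smul, hT i x hx]

theorem homDeg_le_homParity (t : ℤ) : homDeg 𝒱 t ≤ homParity 𝒱 t := fun T hT i x hx => by
  rw [parityProj_apply 𝒱 _ (hT i x hx), if_pos (by push_cast; rfl)]

/-- The extension of an endomorphism `T` of parity `q` to a derivation of the tensor square:
`x ⊗ y ↦ T x ⊗ y + (-1)^(|x| q) x ⊗ T y`. -/
def derExt (q : ZMod 2) : (V →ₗ[K] V) →ₗ[K] (V ⊗[K] V →ₗ[K] V ⊗[K] V) :=
  LinearMap.rTensorHom V +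
    TensorProduct.mapBilinear (RingHom.id K) V V V V (parityTwist 𝒱 q)

theorem derExt_tmul (q : ZMod 2) (T : V →ₗ[K] V) {i : ℤ} {x : V} (hx : x ∈ 𝒱 i) (y : V) :
    derExt 𝒱 q T (x ⊗ₜ[K] y) = T x ⊗ₜ[K] y + psgn (i * q) • (x ⊗ₜ[K] T y) := by
  simp only [derExt, LinearMap.add_apply, LinearMap.coe_rTensorHom, LinearMap.rTensor_tmul,
    TensorProduct.mapBilinear_apply, TensorProduct.map_tmul, parityTwist_apply 𝒱 _ hx,
    TensorProduct.smul_tmul', mul_comm q]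

theorem tensor_linearMap_ext {B : Type*} [AddCommGroup B] [Module K B]
    {φ ψ : V ⊗[K] V →ₗ[K] B}
    (h : ∀ i, ∀ x ∈ 𝒱 i, ∀ y, φ (x ⊗ₜ[K] y) = ψ (x ⊗ₜ[K] y)) : φ = ψ := by
  refine TensorProduct.ext <| linearMap_ext_homogeneous 𝒱 fun i x hx => LinearMap.ext fun y => ?_
  exact h i x hx y

/-- Evaluating at `x ⊗ x` and contracting the second factor with `φ`, where `φ x = 1`, gives `T x ±
φ (T x) x = 0`. With the plus sign, a further `φ` gives `2 φ (T x) = 0`. With the minus sign, `T x`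
is a multiple of `x` while `T` is odd, so `T x` vanishes for reasons of parity. -/
theorem eq_zero_of_derExt_eq_zero (h2 : (2 : K) ≠ 0) {q : ZMod 2} {T : V →ₗ[K] V}
    (hT : T ∈ homParity 𝒱 q) (h : derExt 𝒱 q T = 0) : T = 0 := by
  refine linearMap_ext_homogeneous 𝒱 fun i x hx => ?_
  rw [LinearMap.zero_apply]
  by_cases hx0 : x = 0
  · rw [hx0, map_zero]
  obtain ⟨φ, hφ⟩ : ∃ φ : V →ₗ[K] K, φ x = 1 := by
    obtain ⟨φ, hφ⟩ := LinearMap.exists_extend_of_notMem (p := (⊥ : Submodule K V)) (0 : _ →ₗ[K] K)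
      (show x ∉ (⊥ : Submodule K V) by simpa using hx0) 1
    exact ⟨φ, hφ.2⟩
  have hxx := LinearMap.congr_fun h (x ⊗ₜ[K] x)
  rw [derExt_tmul 𝒱 q T hx, LinearMap.zero_apply] at hxx
  have h1 := congrArg ((TensorProduct.rid K V).toLinearMap ∘ₗ LinearMap.lTensor V φ) hxx
  simp only [map_add, map_zsmul, map_zero, LinearMap.comp_apply, LinearMap.lTensor_tmul,
    LinearEquiv.coe_coe, TensorProduct.rid_tmul, hφ, one_smul] at h1
  rcases psgn_eq_one_or (i * q) with hs | hs <;> rw [hs] at h1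
  · have h3 := congrArg φ h1
    simp only [map_add, map_smul, map_zero, hφ, one_smul, smul_eq_mul, mul_one] at h3
    have h4 : φ (T x) = 0 := by
      have : (2 : K) * φ (T x) = 0 := by linear_combination h3
      exact (mul_eq_zero.1 this).resolve_left h2
    simpa [h4] using h1
  · have hp := hT i x hx
    have hTx : T x = φ (T x) • x := by linear_combination (norm := module) h1
    -- The sign is `-1`, so `q` is nonzero and `T` changes parity.
    have hq : (i : ZMod 2) ≠ i + q := by
      intro h
      have : q = 0 := by simpa using h
      rw [this, mul_zero] at hs
      exact absurd hs (by decide)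
    rw [hTx, map_smul, parityProj_apply 𝒱 _ hx, if_neg hq, smul_zero] at hp
    rw [hTx, ← hp]

/-- A linear left inverse, rather than a pointwise choice of preimages, keeps the reconstructed
components multilinear. It depends only on the parity `q`, so finitely many of them suffice in each
arity. -/
theorem exists_derInv (h2 : (2 : K) ≠ 0) (q : ZMod 2) :
    ∃ ρ : (V ⊗[K] V →ₗ[K] V ⊗[K] V) →ₗ[K] (V →ₗ[K] V),
      ∀ T ∈ homParity 𝒱 q, ρ (derExt 𝒱 q T) = T := by
  obtain ⟨ρ, hρ⟩ := LinearMap.exists_leftInverse_of_injective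
    (derExt 𝒱 q ∘ₗ (homParity 𝒱 q).subtype) (LinearMap.ker_eq_bot'.2 fun T hT =>
      Subtype.ext (eq_zero_of_derExt_eq_zero 𝒱 h2 T.2 hT))
  exact ⟨(homParity 𝒱 q).subtype ∘ₗ ρ, fun T hT =>
    congrArg Subtype.val (LinearMap.congr_fun hρ ⟨T, hT⟩)⟩

/-- The derivations of the tensor square of degree `t` that extend endomorphisms. -/
def derivations (t : ℤ) : Submodule K (V ⊗[K] V →ₗ[K] V ⊗[K] V) :=
  (homDeg 𝒱 t).map (derExt 𝒱 t)

/-- The mixed terms `S x ⊗ T y` and `T x ⊗ S y` cancel in the graded commutator, leaving the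
extension of the graded commutator of `S` and `T`. -/
theorem commutator_mem_derivations {m n : ℤ} {φ ψ : V ⊗[K] V →ₗ[K] V ⊗[K] V}
    (hφ : φ ∈ derivations 𝒱 m) (hψ : ψ ∈ derivations 𝒱 n) :
    φ ∘ₗ ψ - psgn ((m * n : ℤ) : ZMod 2) • ψ ∘ₗ φ ∈ derivations 𝒱 (m + n) := by
  obtain ⟨S, hS, rfl⟩ := hφ
  obtain ⟨T, hT, rfl⟩ := hψ
  refine ⟨S ∘ₗ T - psgn ((m * n : ℤ) : ZMod 2) • T ∘ₗ S, sub_mem (fun i x hx => ?_)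
    (zsmul_mem (fun i x hx => ?_) _), tensor_linearMap_ext 𝒱 fun i x hx y => ?_⟩
  · have := hS _ _ (hT i x hx)
    rwa [show i + n + m = i + (m + n) by ring] at this
  · have := hT _ _ (hS i x hx)
    rwa [show i + m + n = i + (m + n) by ring] at this
  · simp only [LinearMap.sub_apply, LinearMap.smul_apply, LinearMap.comp_apply,
      derExt_tmul 𝒱 _ _ hx, map_add, map_zsmul, derExt_tmul 𝒱 _ _ (hT i x hx),
      derExt_tmul 𝒱 _ _ (hS i x hx), TensorProduct.sub_tmul, TensorProduct.tmul_sub]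
    push_cast
    simp only [mul_add, add_mul, psgn_add, mul_comm (n : ZMod 2) m, ← TensorProduct.smul_tmul',
      TensorProduct.tmul_smul]
    rcases psgn_eq_one_or (m * n) with s1 | s1 <;> rcases psgn_eq_one_or (i * m) with s2 | s2 <;>
    rcases psgn_eq_one_or (i * n) with s3 | s3 <;> rw [s1, s2, s3] <;> module

/-- The families whose component of arity `N + 1` is a derivation in its last argument. -/
def derivationFamilies (n : ℤ) (N : ℕ) : Submodule K (Family K (V ⊗[K] V)) where
  carrier := {f | ∀ (d : Fin N → ℤ) (X : Fin N → V ⊗[K] V),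
    (∀ i, X i ∈ shift (tensorGrading 𝒱) (d i)) →
      (f N).curryRight X ∈ derivations 𝒱 (n + ∑ i, d i)}
  zero_mem' := fun _ _ _ => zero_mem _
  add_mem' := fun hf hg d X hX => add_mem (hf d X hX) (hg d X hX)
  smul_mem' := fun c _ hf d X hX => Submodule.smul_mem _ c (hf d X hX)

theorem mem_derivationFamilies_zero {n : ℤ} {f : Family K (V ⊗[K] V)} :
    f ∈ derivationFamilies 𝒱 n 0 ↔ lin f ∈ derivations 𝒱 n := by
  have h : ∀ X : Fin 0 → V ⊗[K] V, (f 0).curryRight X = lin f := fun X => by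
    refine LinearMap.ext fun z => ?_
    rw [MultilinearMap.curryRight_apply, lin_apply]
    congr 1
  constructor
  · intro hf
    simpa [h] using hf (fun i => i.elim0) (fun i => i.elim0) fun i => i.elim0
  · intro hf d X _
    simpa [h] using hf

/-- This makes the derivation property accessible to the recursion: fixing the first argument leaves
the last one untouched and adds `i` to the degree. -/
theorem mem_derivationFamilies_succ {n : ℤ} {N : ℕ} {f : Family K (V ⊗[K] V)} :
    f ∈ derivationFamilies 𝒱 n (N + 1) ↔ ∀ i, ∀ x ∈ shift (tensorGrading 𝒱) i,
      cur x f ∈ derivationFamilies 𝒱 (n + i) N := by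
  have h : ∀ (x) (X : Fin N → V ⊗[K] V), (f (N + 1)).curryRight (Fin.cons x X) =
      (cur x f N).curryRight X := fun x X => by
    refine LinearMap.ext fun z => ?_
    rw [MultilinearMap.curryRight_apply, MultilinearMap.curryRight_apply, cur_apply,
      Fin.cons_snoc_eq_snoc_cons]
  constructor
  · intro hf i x hx d X hX
    rw [← h, add_assoc]
    have := hf (Fin.cons i d) (Fin.cons x X) fun j => by
      refine Fin.cases ?_ (fun j => ?_) j
      · simpa using hx
      · simpa using hX j
    rwa [Fin.sum_cons] at this
  · intro hf d X hX
    have := hf (d 0) (X 0) (hX 0) (Fin.tail d) (Fin.tail X) fun j => hX j.succ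
    rwa [← h, Fin.cons_self_tail, add_assoc, ← Fin.sum_cons, Fin.cons_self_tail] at this

/-- Arity one is the commutator of derivations. In higher arity, `cur x` of the bracket is a
combination of `cur (lin g x) f`, `cur (lin f x) g` and the brackets of `cur x f` with `g` and of
`f` with `cur x g`. The first two are covered by the hypotheses and the brackets by induction. -/
theorem derivationFamilies_bracket {m n : ℤ} {f g : Family K (V ⊗[K] V)}
    (hf : f ∈ CL (shift (tensorGrading 𝒱)) m) (hg : g ∈ CL (shift (tensorGrading 𝒱)) n)
    (hf' : ∀ N, f ∈ derivationFamilies 𝒱 m N) (hg' : ∀ N, g ∈ derivationFamilies 𝒱 n N) (N : ℕ) :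
    circBilin (shift (tensorGrading 𝒱)) n f g -
      psgn ((m * n : ℤ) : ZMod 2) • circBilin (shift (tensorGrading 𝒱)) m g f ∈
        derivationFamilies 𝒱 (m + n) N := by
  induction N generalizing m n f g with
  | zero =>
    rw [mem_derivationFamilies_zero, map_sub, map_zsmul, lin_circBilin, lin_circBilin]
    exact commutator_mem_derivations 𝒱 ((mem_derivationFamilies_zero 𝒱).1 (hf' 0))
      ((mem_derivationFamilies_zero 𝒱).1 (hg' 0))
  | succ N ih =>
    refine (mem_derivationFamilies_succ 𝒱).2 fun i x hx => ?_
    have hfx := fun N => (mem_derivationFamilies_succ 𝒱).1 (hf' (N + 1))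
    have hgx := fun N => (mem_derivationFamilies_succ 𝒱).1 (hg' (N + 1))
    have h1 := hfx N _ _ (lin_mem hg hx)
    have h2 := hgx N _ _ (lin_mem hf hx)
    have h3 := ih (cur_mem hf hx) hg (fun N => hfx N i x hx) hg'
    have h4 := ih hf (cur_mem hg hx) hf' (fun N => hgx N i x hx)
    rw [show m + (i + n) = m + n + i by ring] at h1
    rw [show n + (i + m) = m + n + i by ring] at h2
    rw [show m + i + n = m + n + i by ring] at h3
    rw [show m + (n + i) = m + n + i by ring] at h4
    convert add_mem (add_mem (sub_mem h1 (zsmul_mem h2 (psgn ((m * n : ℤ) : ZMod 2))))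
      (zsmul_mem h3 (psgn ((n * i : ℤ) : ZMod 2)))) h4 using 1
    rw [map_sub, map_zsmul, cur_circBilin _ _ _ _ hx, cur_circBilin _ _ _ _ hx]
    push_cast
    simp only [mul_add, add_mul, psgn_add, mul_comm (i : ZMod 2)]
    rcases psgn_eq_one_or (m * n) with s1 | s1 <;> rcases psgn_eq_one_or (m * i) with s2 | s2 <;>
    rcases psgn_eq_one_or (n * i) with s3 | s3 <;> rw [s1, s2, s3] <;> module

end HomotopyNambu

/-! ### The image of `Psi` and transfer of the Lie structure -/

namespace HomotopyNambu

variable {K V : Type*} [Field K] [AddCommGroup V] [Module K V]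
  (𝒱 : ℤ → Submodule K V) [DirectSum.Decomposition 𝒱]

theorem leibnizExt_curryRight (n : ℤ) (a : ℕ)
    (F : MultilinearMap K (fun _ : Fin a => V ⊗[K] V) (V →ₗ[K] V)) (d : Fin a → ℤ)
    (X : Fin a → V ⊗[K] V) (hX : ∀ i, X i ∈ tensorGrading 𝒱 (d i)) :
    (leibnizExt 𝒱 n a F).curryRight X = derExt 𝒱 ((∑ i, d i) + n + a : ℤ) (F X) := by
  refine tensor_linearMap_ext 𝒱 fun i x hx y => ?_
  rw [MultilinearMap.curryRight_apply, leibnizExt_apply 𝒱 n a F d i X x y hX hx,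
    derExt_tmul 𝒱 _ _ hx]
  push_cast
  rfl

/-- The map `Psi` on families, without degree constraints. -/
def psiFamily (n : ℤ) : NambuFamily K V →ₗ[K] Family K (V ⊗[K] V) where
  toFun f a := (-1 : ℤ) ^ ((a + 1) * a / 2) • leibnizExt 𝒱 n a (f a)
  map_add' f g := funext fun a => by simp only [Pi.add_apply, leibnizExt_add, smul_add]
  map_smul' c f := funext fun a => by
    simp only [Pi.smul_apply, leibnizExt_smul, RingHom.id_apply]
    rw [smul_comm]

theorem coe_Psi (n : ℤ) (f : CV 𝒱 n) :
    (Psi 𝒱 n f : Family K (V ⊗[K] V)) = psiFamily 𝒱 n f.1 := rfl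

theorem apply_mem_homDeg {𝒲 : ℤ → Submodule K V} {n : ℤ} {f : NambuFamily K V}
    (hf : f ∈ CV 𝒲 n) {a : ℕ} {d : Fin a → ℤ}
    {X : Fin a → V ⊗[K] V} (hX : ∀ i, X i ∈ tensorGrading 𝒲 (d i)) :
    f a X ∈ homDeg 𝒲 ((∑ i, d i) + n + a) := fun i x hx => by
  have := hf a d i X x hX hx
  rwa [show (∑ i, d i) + i + (n + a) = i + ((∑ i, d i) + n + a) by ring] at this

/-- The suspension accounts for the degree `n + a` in `CV`: each of the `N` suspended arguments has
degree one more than the tensor below it, so the derivation has degree `n` plus the sum of the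
suspended degrees. -/
theorem psi_mem_derivationFamilies {n : ℤ} (f : CV 𝒱 n) (N : ℕ) :
    (Psi 𝒱 n f : Family K (V ⊗[K] V)) ∈ derivationFamilies 𝒱 n N := by
  intro d X hX
  have h : (psiFamily 𝒱 n f.1 N).curryRight X =
      (-1 : ℤ) ^ ((N + 1) * N / 2) • (leibnizExt 𝒱 n N (f.1 N)).curryRight X := rfl
  rw [coe_Psi, h, leibnizExt_curryRight 𝒱 n N _ (fun i => d i - 1) X hX]
  have hd : ∑ i, (d i - 1) + n + N = n + ∑ i, d i := by
    simp [Finset.sum_sub_distrib]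
    ring
  have hT := apply_mem_homDeg f.2 (d := fun i => d i - 1) hX
  rw [hd] at hT ⊢
  exact zsmul_mem (Submodule.mem_map_of_mem hT) _

theorem psiFamily_injOn (h2 : (2 : K) ≠ 0) {n : ℤ} {f : NambuFamily K V} (hf : f ∈ CV 𝒱 n)
    (h : psiFamily 𝒱 n f = 0) : f = 0 := by
  funext a
  refine multilinearMap_ext_homogeneous (tensorGrading 𝒱) fun d X hX => ?_
  have h1 : (-1 : ℤ) ^ ((a + 1) * a / 2) • leibnizExt 𝒱 n a (f a) = 0 := congrFun h a
  have h3 : leibnizExt 𝒱 n a (f a) = 0 := by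
    rcases neg_one_pow_eq_or ℤ ((a + 1) * a / 2) with hs | hs <;> simpa [hs] using h1
  have h4 := leibnizExt_curryRight 𝒱 n a (f a) d X hX
  rw [h3] at h4
  exact eq_zero_of_derExt_eq_zero 𝒱 h2
    (homDeg_le_homParity 𝒱 _ (apply_mem_homDeg hf hX)) h4.symm

theorem psi_injective (h2 : (2 : K) ≠ 0) (n : ℤ) : Function.Injective (Psi 𝒱 n) :=
  (injective_iff_map_eq_zero _).2 fun f hf =>
    Subtype.ext (psiFamily_injOn 𝒱 h2 f.2 (congrArg Subtype.val hf))

/-- The derivation property gives an endomorphism of `V` for each homogeneous tuple; the linear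
inverses of `derExt`, glued over parities, assemble these into multilinear maps. -/
theorem exists_psi_eq (h2 : (2 : K) ≠ 0) {n : ℤ} (F : CL (shift (tensorGrading 𝒱)) n)
    (hF : ∀ N, F.1 ∈ derivationFamilies 𝒱 n N) : ∃ f, Psi 𝒱 n f = F := by
  choose ρ hρ using exists_derInv 𝒱 h2
  have key : ∀ (a : ℕ) (d : Fin a → ℤ) (X : Fin a → V ⊗[K] V)
      (_ : ∀ i, X i ∈ tensorGrading 𝒱 (d i)), ∃ T ∈ homDeg 𝒱 ((∑ i, d i) + n + a),
        (F.1 a).curryRight X = derExt 𝒱 ((∑ i, d i) + n + a : ℤ) T := by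
    intro a d X hX
    obtain ⟨T, hT, h⟩ := hF a (fun i => d i + 1) X fun i => by simpa [shift] using hX i
    have hd : n + ∑ i, (d i + 1) = (∑ i, d i) + n + a := by
      simp [Finset.sum_add_distrib]
      ring
    rw [hd] at hT h
    exact ⟨T, hT, h.symm⟩
  -- The inverse of `derExt` depends on the parities of the arguments, hence the sum over `d`; on
  -- homogeneous arguments one summand survives. The sign is its own inverse, so it is the one
  -- occurring in `Psi`.
  let f : NambuFamily K V := fun a => (-1 : ℤ) ^ ((a + 1) * a / 2) • ∑ d : Fin a → ZMod 2,
    (ρ ((∑ i, d i) + n + a)).compMultilinearMap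
      ((F.1 a).curryRight.compLinearMap fun i => parityProj (tensorGrading 𝒱) (d i))
  have hf : ∀ (a : ℕ) (d : Fin a → ℤ) (X : Fin a → V ⊗[K] V)
      (_ : ∀ i, X i ∈ tensorGrading 𝒱 (d i)) (T : V →ₗ[K] V)
      (_ : T ∈ homDeg 𝒱 ((∑ i, d i) + n + a))
      (_ : (F.1 a).curryRight X = derExt 𝒱 ((∑ i, d i) + n + a : ℤ) T),
      f a X = (-1 : ℤ) ^ ((a + 1) * a / 2) • T := by
    intro a d X hX T hT h
    have h1 := sum_parityProj (tensorGrading 𝒱) (fun d : Fin a → ZMod 2 =>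
      (ρ ((∑ i, d i) + n + a)).compMultilinearMap (F.1 a).curryRight) d X hX
    simp only [f, smul_apply, sum_apply]
    congr 1
    refine h1.trans ?_
    rw [LinearMap.compMultilinearMap_apply, h]
    have := hρ _ T (homDeg_le_homParity 𝒱 _ hT)
    push_cast at this ⊢
    exact this
  have hfm : f ∈ CV 𝒱 n := by
    intro a d e X x hX hx
    obtain ⟨T, hT, h⟩ := key a d X hX
    rw [hf a d X hX T hT h]
    have := hT e x hx
    rw [show e + ((∑ i, d i) + n + a) = (∑ i, d i) + e + (n + a) by ring] at this
    exact zsmul_mem this _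
  refine ⟨⟨f, hfm⟩, Subtype.ext <| funext fun a => ?_⟩
  rw [coe_Psi, ← (F.1 a).uncurry_curryRight, ← (psiFamily 𝒱 n f a).uncurry_curryRight]
  congr 1
  refine multilinearMap_ext_homogeneous (tensorGrading 𝒱) fun d X hX => ?_
  obtain ⟨T, hT, h⟩ := key a d X hX
  have h1 : (psiFamily 𝒱 n f a).curryRight X =
      (-1 : ℤ) ^ ((a + 1) * a / 2) • (leibnizExt 𝒱 n a (f a)).curryRight X := rfl
  rw [h1, leibnizExt_curryRight 𝒱 n a _ d X hX, h, hf a d X hX T hT h, map_zsmul, smul_smul,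
    ← mul_pow]
  simp

/-- This is where the bracket is well defined: `Function.invFun` would take an arbitrary value
outside the image, and the closure of derivation families under the bracket rules that out. -/
theorem psi_nambuBracket (h2 : (2 : K) ≠ 0) (m n : ℤ) (f : CV 𝒱 m) (g : CV 𝒱 n) :
    Psi 𝒱 (m + n) (nambuBracket 𝒱 m n f g) =
      balavoineBracket (shift (tensorGrading 𝒱)) m n (Psi 𝒱 m f) (Psi 𝒱 n g) :=
  Function.invFun_eq <| exists_psi_eq 𝒱 h2 _ <| derivationFamilies_bracket 𝒱 (Psi 𝒱 m f).2
    (Psi 𝒱 n g).2 (psi_mem_derivationFamilies 𝒱 f) (psi_mem_derivationFamilies 𝒱 g)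

theorem nambuBracket_mem {m n k : ℤ} (hk : m + n = k) (f : CV 𝒱 m) (g : CV 𝒱 n) :
    (nambuBracket 𝒱 m n f g : NambuFamily K V) ∈ CV 𝒱 k := by
  subst hk
  exact Subtype.prop _

/-- Skew symmetry and Jacobi compare elements whose degrees agree only propositionally, such as `m +
n + p` and `m + (n + p)`. Both sides are therefore compared in the ambient space of families, with
the degree `k` free. -/
theorem psiFamily_nambuBracket (h2 : (2 : K) ≠ 0) {m n k : ℤ} (hk : m + n = k) (f : CV 𝒱 m)
    (g : CV 𝒱 n) : psiFamily 𝒱 k (nambuBracket 𝒱 m n f g : NambuFamily K V) =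
      balavoineBracket (shift (tensorGrading 𝒱)) m n (Psi 𝒱 m f) (Psi 𝒱 n g) := by
  subst hk
  exact congrArg Subtype.val (psi_nambuBracket 𝒱 h2 m n f g)

theorem eq_of_psiFamily_eq (h2 : (2 : K) ≠ 0) {n : ℤ} {f g : NambuFamily K V} (hf : f ∈ CV 𝒱 n)
    (hg : g ∈ CV 𝒱 n) (h : psiFamily 𝒱 n f = psiFamily 𝒱 n g) : f = g :=
  sub_eq_zero.1 <| psiFamily_injOn 𝒱 h2 (sub_mem hf hg) (by rw [map_sub, h, sub_self])

theorem nambu_isGradedLieAlgebra (h2 : (2 : K) ≠ 0) :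
    IsGradedLieAlgebra (CV 𝒱) (nambuBracket 𝒱) := by
  have hL := balavoine_isGradedLieAlgebra (shift (tensorGrading 𝒱))
  refine ⟨fun m n x x' y => ?_, fun m n x y y' => ?_, fun m n c x y => ?_, fun m n c x y => ?_,
    fun m n x y => ?_, fun m n p x y z => ?_⟩
  · apply psi_injective 𝒱 h2
    simp only [map_add, psi_nambuBracket 𝒱 h2, hL.add_left]
  · apply psi_injective 𝒱 h2
    simp only [map_add, psi_nambuBracket 𝒱 h2, hL.add_right]
  · apply psi_injective 𝒱 h2
    simp only [map_smul, psi_nambuBracket 𝒱 h2, hL.smul_left]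
  · apply psi_injective 𝒱 h2
    simp only [map_smul, psi_nambuBracket 𝒱 h2, hL.smul_right]
  · have h1 := nambuBracket_mem 𝒱 (add_comm n m) y x
    refine eq_of_psiFamily_eq 𝒱 h2 (nambuBracket 𝒱 m n x y).2 (neg_mem (zsmul_mem h1 _)) ?_
    rw [map_neg, map_zsmul, psiFamily_nambuBracket 𝒱 h2 rfl,
      psiFamily_nambuBracket 𝒱 h2 (add_comm n m), hL.skew]
  · have e1 : m + n + p = m + (n + p) := by ring
    have e2 : n + (m + p) = m + (n + p) := by ring
    have h1 := nambuBracket_mem 𝒱 e1 (nambuBracket 𝒱 m n x y) z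
    have h3 := nambuBracket_mem 𝒱 e2 y (nambuBracket 𝒱 m p x z)
    refine eq_of_psiFamily_eq 𝒱 h2 (Subtype.prop _) (add_mem h1 (zsmul_mem h3 _)) ?_
    rw [map_add, map_zsmul, psiFamily_nambuBracket 𝒱 h2 rfl, psiFamily_nambuBracket 𝒱 h2 e1,
      psiFamily_nambuBracket 𝒱 h2 e2]
    simp only [psi_nambuBracket 𝒱 h2]
    exact hL.jacobi m n p _ _ _

theorem psi_isGradedLieHom (h2 : (2 : K) ≠ 0) :
    IsGradedLieHom (CV 𝒱) (CL (shift (tensorGrading 𝒱))) (nambuBracket 𝒱)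
      (balavoineBracket (shift (tensorGrading 𝒱))) (Psi 𝒱) :=
  ⟨nambu_isGradedLieAlgebra 𝒱 h2, balavoine_isGradedLieAlgebra _, psi_nambuBracket 𝒱 h2⟩

theorem isLeibnizInfinity_psi (h2 : (2 : K) ≠ 0) {π : CV 𝒱 1} (hπ : IsHomotopyNambu 𝒱 π) :
    IsLeibnizInfinity (shift (tensorGrading 𝒱)) (Psi 𝒱 1 π) := by
  have hπ : nambuBracket 𝒱 1 1 π π = 0 := hπ
  rw [IsLeibnizInfinity, IsMaurerCartan, ← psi_nambuBracket 𝒱 h2, hπ, map_zero]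

end HomotopyNambu

theorem mainTheorem4 {K V : Type*} [Field K] [AddCommGroup V] [Module K V] (h2 : (2 : K) ≠ 0)
    (𝒱 : ℤ → Submodule K V) [DirectSum.Decomposition 𝒱] :
    (∀ n : ℤ, Function.Injective (HomotopyNambu.Psi 𝒱 n)) ∧
    HomotopyNambu.IsGradedLieHom
      (HomotopyNambu.CV 𝒱)
      (HomotopyNambu.CL (HomotopyNambu.shift (HomotopyNambu.tensorGrading 𝒱)))
      (HomotopyNambu.nambuBracket 𝒱)
      (HomotopyNambu.balavoineBracket (HomotopyNambu.shift (HomotopyNambu.tensorGrading 𝒱)))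
      (HomotopyNambu.Psi 𝒱) ∧
    ∀ π : HomotopyNambu.CV 𝒱 1, HomotopyNambu.IsHomotopyNambu 𝒱 π →
      ∃ ℓ : HomotopyNambu.CL (HomotopyNambu.shift (HomotopyNambu.tensorGrading 𝒱)) 1,
        ℓ = HomotopyNambu.Psi 𝒱 1 π ∧
        HomotopyNambu.IsLeibnizInfinity
          (HomotopyNambu.shift (HomotopyNambu.tensorGrading 𝒱)) ℓ ∧
        ∀ (a : ℕ) (d : Fin a → ℤ) (e : ℤ) (X : Fin a → V ⊗[K] V) (x y : V),
          (∀ i, X i ∈ HomotopyNambu.tensorGrading 𝒱 (d i)) → x ∈ 𝒱 e →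
          ℓ.1 a (Fin.snoc X (x ⊗ₜ[K] y)) =
            (-1 : ℤ) ^ ((a + 1) * a / 2) •
              (π.1 a X x ⊗ₜ[K] y +
                HomotopyNambu.psgn ((e * ((∑ i, d i) + (a + 1)) : ℤ) : ZMod 2) •
                  (x ⊗ₜ[K] π.1 a X y)) := by
  refine ⟨HomotopyNambu.psi_injective 𝒱 h2, HomotopyNambu.psi_isGradedLieHom 𝒱 h2, fun π hπ =>
    ⟨_, rfl, HomotopyNambu.isLeibnizInfinity_psi 𝒱 h2 hπ, fun a d e X x y hX hx => ?_⟩⟩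
  -- The degree `a + 1` is regrouped as `n + a` with `n = 1`, the form in which the sign appears in
  -- `leibnizExt_apply`.
  rw [← add_assoc, add_right_comm, ← HomotopyNambu.leibnizExt_apply 𝒱 1 a (π.1 a) d e X x y hX hx]
  rfl
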